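/- Let $p$ be a prime and let $n, m \ge 0$ be integers. Let $S^n \subset \mathbb{R}^{n+1}$ and $S^m \subset \mathbb{R}^{m+1}$ be the unit spheres, each equipped with a free continuous action of the cyclic group $\mathbb{Z}_p = \mathbb{Z}/p\mathbb{Z}$, where an action is free if $gx = x$ for some point $x$ implies that $g$ is the identity element. If there is a continuous map $f : S^n \to S^m$ that is $\mathbb{Z}_p$-equivariant, i.e. $f(gx) = g f(x)$ for all $g \in \mathbb{Z}_p$ and $x \in S^n$, then $n \le m$. -/

import Mathlib

/-!
Suppose `m < n`. Write `G = ZMod p`, and let `E` be the join of `m + 2` copies of `G`, a free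
`G`-complex of dimension `m + 1 ≤ n`. The proof composes an equivariant map `E → S ^ n` with `f`,
and shows that no equivariant map `E → S ^ m` exists. The actions on the spheres are only assumed
to be continuous, so no linear structure or triangulation compatible with them is available; all that
is used about a space `X` is the property `AvoidsZero X n`: maps `X → ℝ ^ (n + 1)` can be approximated
by maps without zeros. By smooth approximation it holds for every closed set of Hausdorff
dimension less than `n + 1` (`avoidsZero_of_dimH_lt`), in particular for `S ^ m` and for `E`.

* The map `E → S ^ n` (`AvoidsZero.exists_equivariant`). Maps to `S ^ n` extend from closed subsets
  of `E`, and `E` is covered by finitely many closed sets that are disjoint from their translates.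
  One extends over these sets one after another, and equivariantly over their translates.

* A labelling of `S ^ m` (`AvoidsZero.exists_labelling`). For generic real functions
  `u_1, …, u_N`, the maximum of all translates of the `u_j` is attained at each point by at most
  `m + 1` translates, at most one for each `j`. Labelling a point by one of these translates gives
  an equivariant map `S ^ m → ℕ × G` under which small sets of points go to vertices of simplices of
  dimension at most `m` in a free `G`-complex. The first component of a label, the colour, is
  injective on each of these simplices.

* The contradiction (`not_exists_equivariant_joinSpace`). In the chains of ordered tuples of points
  of `E` there are chains `c_0, …, c_{m+2}` with boundaries as in the periodic resolution of `G`
  (`IsResolution`), and barycentric subdivision makes them arbitrarily fine. Equivariant chain maps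
  preserve this property, so it persists for the chains of tuples of labels in `S ^ m`. A second
  subdivision, using as new vertices the entries with the largest colour, gives tuples along which
  the colours decrease. There are explicit cochains on tuples of elements of `G`, products of the
  tautological class in degree one and the Bockstein class in degree two, which take the value `1`
  on any resolution chains (`IsResolution.eval_fundClass`) and vanish on tuples with equal
  neighbours. A tuple of `m + 2` labels with decreasing colours taken from at most `m + 1` labels
  has equal neighbours, so the value is also `0`.
-/

/-! ### Chains on ordered tuples -/

namespace ListChain

variable {R : Type*} [CommRing R] {V W : Type*}

/-- Chains of ordered tuples: the free module on the lists with entries in `V`. A list of length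
`k + 1` plays the role of an ordered `k`-simplex, and the empty list sits in the augmentation
degree `-1`. -/
abbrev Chain (R : Type*) [CommRing R] (V : Type*) := List V →₀ R

/-- The cone operator, putting the vertex `a` in front of every tuple. -/
noncomputable def cone (a : V) : Chain R V →ₗ[R] Chain R V := Finsupp.lmapDomain R R (List.cons a)

/-- The map of chains induced by a map of vertices. -/
noncomputable def map (f : V → W) : Chain R V →ₗ[R] Chain R W :=
  Finsupp.lmapDomain R R (List.map f)

/-- The alternating sum of the faces of a tuple. -/
noncomputable def bdryList : List V → Chain R V
  | [] => 0
  | a :: l => Finsupp.single l 1 - cone a (bdryList l)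

/-- The (augmented) boundary operator. -/
noncomputable def bdry : Chain R V →ₗ[R] Chain R V := Finsupp.linearCombination R bdryList

@[simp] lemma cone_single (a : V) (l : List V) (r : R) :
    cone a (Finsupp.single l r) = Finsupp.single (a :: l) r := by
  simp [cone]

@[simp] lemma map_single (f : V → W) (l : List V) (r : R) :
    map f (Finsupp.single l r) = Finsupp.single (l.map f) r := by
  simp [map]

@[simp] lemma bdry_single_nil (r : R) : bdry (Finsupp.single ([] : List V) r) = 0 := by
  simp [bdry, bdryList]

lemma bdry_single (l : List V) : bdry (Finsupp.single l (1 : R)) = bdryList l := by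
  simp [bdry]

lemma bdry_cone (a : V) (c : Chain R V) : bdry (cone a c) = c - cone a (bdry c) := by
  induction c using Finsupp.induction_linear with
  | zero => simp
  | add c d hc hd => simp only [map_add, hc, hd]; abel
  | single l r =>
    simp [bdry, bdryList, smul_sub]

lemma bdry_single_cons (a : V) (l : List V) (r : R) :
    bdry (Finsupp.single (a :: l) r) =
      Finsupp.single l r - cone a (bdry (Finsupp.single l r)) := by
  rw [← cone_single, bdry_cone]

lemma bdry_bdry (c : Chain R V) : bdry (bdry c) = 0 := by
  induction c using Finsupp.induction_linear with
  | zero => simp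
  | add c d hc hd => simp only [map_add, hc, hd, add_zero]
  | single l r =>
    induction l with
    | nil => simp
    | cons a l ih => simp [bdry_single_cons, bdry_cone, ih]

lemma map_cone (f : V → W) (a : V) (c : Chain R V) : map f (cone a c) = cone (f a) (map f c) := by
  induction c using Finsupp.induction_linear with
  | zero => simp
  | add c d hc hd => simp only [map_add, hc, hd]
  | single l r => simp

lemma map_bdry (f : V → W) (c : Chain R V) : map f (bdry c) = bdry (map f c) := by
  induction c using Finsupp.induction_linear with
  | zero => simp
  | add c d hc hd => simp only [map_add, hc, hd]
  | single l r =>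
    induction l with
    | nil => simp
    | cons a l ih => simp [bdry_single_cons, map_cone, ih]

lemma map_map {U : Type*} (f : V → W) (g : W → U) (c : Chain R V) :
    map g (map f c) = map (g ∘ f) c := by
  induction c using Finsupp.induction_linear with
  | zero => simp
  | add c d hc hd => simp only [map_add, hc, hd]
  | single l r => simp

/-! ### Chains supported on prescribed tuples -/

/-- A linear map sends chains supported on `P` to chains supported on `Q` if it does so on the
tuples in `P`. -/
lemma mem_supported_of_forall {P : Set (List V)} {Q : Set (List W)}
    {φ : Chain R V →ₗ[R] Chain R W}
    (h : ∀ l ∈ P, φ (Finsupp.single l 1) ∈ Finsupp.supported R R Q)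
    {c : Chain R V} (hc : c ∈ Finsupp.supported R R P) : φ c ∈ Finsupp.supported R R Q := by
  rw [Finsupp.supported_eq_span_single] at hc
  induction hc using Submodule.span_induction with
  | mem x hx => obtain ⟨l, hl, rfl⟩ := hx; exact h l hl
  | zero => simp
  | add x y _ _ hx hy => rw [map_add]; exact add_mem hx hy
  | smul r x _ hx => rw [map_smul]; exact Submodule.smul_mem _ _ hx

lemma eq_of_forall_mem {M : Type*} [AddCommGroup M] [Module R M] {P : Set (List V)}
    {φ ψ : Chain R V →ₗ[R] M}
    (h : ∀ l ∈ P, φ (Finsupp.single l 1) = ψ (Finsupp.single l 1))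
    {c : Chain R V} (hc : c ∈ Finsupp.supported R R P) : φ c = ψ c := by
  rw [Finsupp.supported_eq_span_single] at hc
  induction hc using Submodule.span_induction with
  | mem x hx => obtain ⟨l, hl, rfl⟩ := hx; exact h l hl
  | zero => simp
  | add x y _ _ hx hy => rw [map_add, map_add, hx, hy]
  | smul r x _ hx => rw [map_smul, map_smul, hx]

lemma supported_mono {P Q : Set (List V)} (h : P ⊆ Q) {c : Chain R V}
    (hc : c ∈ Finsupp.supported R R P) : c ∈ Finsupp.supported R R Q :=
  Finsupp.supported_mono h hc

lemma mem_supported_inter {P Q : Set (List V)} {c : Chain R V}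
    (hP : c ∈ Finsupp.supported R R P) (hQ : c ∈ Finsupp.supported R R Q) :
    c ∈ Finsupp.supported R R (P ∩ Q) :=
  fun _ hl => ⟨hP hl, hQ hl⟩

lemma map_mem_supported {P : Set (List V)} {Q : Set (List W)} {f : V → W}
    (h : ∀ l ∈ P, l.map f ∈ Q) {c : Chain R V} (hc : c ∈ Finsupp.supported R R P) :
    map f c ∈ Finsupp.supported R R Q :=
  mem_supported_of_forall (fun l hl => by
    rw [map_single]; exact Finsupp.single_mem_supported R 1 (h l hl)) hc

lemma cone_mem_supported {P Q : Set (List V)} {a : V} (h : ∀ l ∈ P, a :: l ∈ Q) {c : Chain R V}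
    (hc : c ∈ Finsupp.supported R R P) : cone a c ∈ Finsupp.supported R R Q :=
  mem_supported_of_forall (fun l hl => by
    rw [cone_single]; exact Finsupp.single_mem_supported R 1 (h l hl)) hc

/-- The faces of a tuple are sublists of it, shorter by one entry. -/
lemma bdryList_mem_supported (l : List V) :
    (bdryList l : Chain R V) ∈
      Finsupp.supported R R {l' : List V | l'.Sublist l ∧ l'.length + 1 = l.length} := by
  induction l with
  | nil => simp [bdryList]
  | cons a l ih =>
    refine sub_mem (Finsupp.single_mem_supported R 1 ?_) ?_
    · exact ⟨List.sublist_cons_self a l, rfl⟩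
    · refine cone_mem_supported ?_ ih
      rintro l' ⟨h1, h2⟩
      exact ⟨h1.cons_cons a, by simp [h2]⟩

/-! ### Subdivision -/

/-- Generalized barycentric subdivision of tuples with `k` entries (tuples of other lengths are sent
to `0`). The function `b` prescribes the new vertex attached to each tuple, and a tuple `l` is sent
to the cone with apex `b l` over the subdivision of its boundary. -/
noncomputable def sd (b : List V → W) : ℕ → Chain R V →ₗ[R] Chain R W
  | 0 => Finsupp.lsingle [] ∘ₗ Finsupp.lapply []
  | k + 1 => Finsupp.linearCombination R fun l => cone (b l) (sd b k (bdryList l))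

lemma sd_zero_nil (b : List V → W) :
    sd b 0 (Finsupp.single [] (1 : R)) = Finsupp.single [] 1 := by
  simp [sd]

lemma sd_succ_single (b : List V → W) (k : ℕ) (l : List V) (r : R) :
    sd b (k + 1) (Finsupp.single l r) = cone (b l) (sd b k (bdry (Finsupp.single l r))) := by
  simp [sd, bdry]

/-- Whatever the choice of the new vertices, subdivision commutes with the boundary. -/
lemma bdry_sd (b : List V → W) (k : ℕ) (c : Chain R V) :
    bdry (sd b (k + 1) c) = sd b k (bdry c) := by
  induction k generalizing c with
  | zero =>
    induction c using Finsupp.induction_linear with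
    | zero => simp
    | add c d hc hd => simp only [map_add, hc, hd]
    | single l r =>
      rw [sd_succ_single, bdry_cone]
      simp [sd]
  | succ k ih =>
    induction c using Finsupp.induction_linear with
    | zero => simp
    | add c d hc hd => simp only [map_add, hc, hd]
    | single l r =>
      rw [sd_succ_single, bdry_cone, ih, bdry_bdry]
      simp

/-- Subdivision is equivariant if the choice of the new vertices is. -/
lemma map_sd {V' W' : Type*} {b : List V → W} {b' : List V' → W'} {f : V → V'} {g : W → W'}
    (h : ∀ l, l ≠ [] → b' (l.map f) = g (b l)) (k : ℕ) (c : Chain R V) :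
    map g (sd b k c) = sd b' k (map f c) := by
  induction k generalizing c with
  | zero =>
    induction c using Finsupp.induction_linear with
    | zero => simp
    | add c d hc hd => simp only [map_add, hc, hd]
    | single l r =>
      cases l <;> simp [sd]
  | succ k ih =>
    induction c using Finsupp.induction_linear with
    | zero => simp
    | add c d hc hd => simp only [map_add, hc, hd]
    | single l r =>
      rcases eq_or_ne l [] with rfl | hl
      · simp [sd_succ_single]
      · rw [sd_succ_single, map_cone, ih, map_bdry, map_single, sd_succ_single, h l hl]

lemma sd_mem_supported_length (b : List V → W) (k : ℕ) (c : Chain R V) :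
    sd b k c ∈ Finsupp.supported R R {l : List W | l.length = k} := by
  induction k generalizing c with
  | zero => exact Finsupp.single_mem_supported R _ (by simp)
  | succ k ih =>
    induction c using Finsupp.induction_linear with
    | zero => simp
    | add c d hc hd => rw [map_add]; exact add_mem hc hd
    | single l r =>
      rw [sd_succ_single]
      exact cone_mem_supported (fun l hl => by simpa using hl) (ih _)

/-- To control the tuples in the subdivision of `l`, let `Q l` be the set of allowed tuples: it
has to contain `b l :: l''` whenever `l''` is allowed for a face of `l`. -/
lemma sd_single_mem_supported {b : List V → W} {Q : List V → Set (List W)}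
    (h0 : ∀ l, [] ∈ Q l)
    (h : ∀ l l' l'', l'.Sublist l → l'.length + 1 = l.length → l'' ∈ Q l' → b l :: l'' ∈ Q l)
    (k : ℕ) (l : List V) :
    sd b k (Finsupp.single l (1 : R)) ∈ Finsupp.supported R R (Q l) := by
  induction k generalizing l with
  | zero => exact Finsupp.single_mem_supported R _ (h0 l)
  | succ k ih =>
    rw [sd_succ_single, bdry_single]
    refine cone_mem_supported
      (P := ⋃ l' ∈ {l' : List V | l'.Sublist l ∧ l'.length + 1 = l.length}, Q l')
      (fun l'' hl'' => ?_) ?_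
    · simp only [Set.mem_iUnion] at hl''
      obtain ⟨l', hl', hl''⟩ := hl''
      exact h l l' l'' hl'.1 hl'.2 hl''
    · refine mem_supported_of_forall (fun l' hl' => ?_) (bdryList_mem_supported l)
      exact supported_mono (Set.subset_biUnion_of_mem (u := fun l' => Q l') hl') (ih l')

end ListChain

/-! ### Equivariant resolution chains -/

namespace ListChain

variable {p : ℕ} [Fact p.Prime] {V W : Type*}

/-- The operators of the periodic resolution of `ZMod p`: the identity in degree zero, then
alternately `g - 1` for the generator `g` of the group, and the norm `∑ g`. -/
noncomputable def periodic (τ : ZMod p → V → V) :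
    ℕ → Chain (ZMod p) V →ₗ[ZMod p] Chain (ZMod p) V
  | 0 => LinearMap.id
  | k + 1 => if Even k then map (τ 1) - LinearMap.id else ∑ t, map (τ t)

/-- A sequence of chains whose boundaries are linked as in the periodic resolution of `ZMod p`, up
to the index `M`; here `d k` stands in degree `k - 1`. -/
structure IsResolution (τ : ZMod p → V → V) (M : ℕ) (d : ℕ → Chain (ZMod p) V) : Prop where
  zero : d 0 = Finsupp.single [] 1
  succ : ∀ k < M, bdry (d (k + 1)) = periodic τ k (d k)

/-- Resolution chains are preserved by equivariant chain maps. -/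
lemma IsResolution.push {τ : ZMod p → V → V} {τ' : ZMod p → W → W} {M : ℕ}
    {d : ℕ → Chain (ZMod p) V} (hd : IsResolution τ M d)
    (Φ : ℕ → Chain (ZMod p) V →ₗ[ZMod p] Chain (ZMod p) W)
    (h0 : Φ 0 (Finsupp.single [] 1) = Finsupp.single [] 1)
    (hb : ∀ k c, bdry (Φ (k + 1) c) = Φ k (bdry c))
    (he : ∀ k ≤ M, ∀ g, Φ k (map (τ g) (d k)) = map (τ' g) (Φ k (d k))) :
    IsResolution τ' M fun k => Φ k (d k) := by
  refine ⟨by rw [hd.zero, h0], fun k hkM => ?_⟩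
  rw [hb, hd.succ k hkM]
  cases k with
  | zero => simp [periodic]
  | succ k =>
    by_cases hk : Even k
    · simp [periodic, hk, he _ hkM.le]
    · simp [periodic, hk, he _ hkM.le]

lemma periodic_bdry (τ : ZMod p → V → V) (k : ℕ) (c : Chain (ZMod p) V) :
    periodic τ k (bdry c) = bdry (periodic τ k c) := by
  cases k with
  | zero => simp [periodic]
  | succ k => by_cases hk : Even k <;> simp [periodic, hk, map_bdry]

lemma periodic_periodic {τ : ZMod p → V → V} (hτ : ∀ s t v, τ s (τ t v) = τ (s + t) v)
    (k : ℕ) (c : Chain (ZMod p) V) : periodic τ (k + 2) (periodic τ (k + 1) c) = 0 := by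
  have hcomp : ∀ s t, τ s ∘ τ t = τ (s + t) := fun s t => funext (hτ s t)
  have hsum (f : ZMod p → Chain (ZMod p) V) : ∑ t, f (t + 1) = ∑ t, f t :=
    Equiv.sum_comp (Equiv.addRight (1 : ZMod p)) f
  have hsum' (f : ZMod p → Chain (ZMod p) V) : ∑ t, f (1 + t) = ∑ t, f t :=
    Equiv.sum_comp (Equiv.addLeft (1 : ZMod p)) f
  by_cases hk : Even k
  · simp [periodic, hk, Nat.even_add_one, map_map, hcomp, hsum fun t => map (τ t) c]
  · simp [periodic, hk, Nat.even_add_one, map_map, hcomp, hsum' fun t => map (τ t) c]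

/-- The standard resolution chains in the iterated join of copies of `ZMod p`. The vertices of the
`i`-th copy are the pairs `(i, g)`. -/
noncomputable def joinChain (p : ℕ) [Fact p.Prime] : ℕ → Chain (ZMod p) (ℕ × ZMod p)
  | 0 => Finsupp.single [] 1
  | k + 1 => cone (k, 0) (periodic (fun g q => (q.1, g + q.2)) k (joinChain p k))

lemma isResolution_joinChain (M : ℕ) :
    IsResolution (fun g (q : ℕ × ZMod p) => (q.1, g + q.2)) M (joinChain p) := by
  refine ⟨rfl, fun k _ => ?_⟩
  rw [joinChain, bdry_cone, ← periodic_bdry]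
  suffices h : periodic (fun g (q : ℕ × ZMod p) => (q.1, g + q.2)) k (bdry (joinChain p k)) = 0 by
    rw [h, map_zero, sub_zero]
  clear * -
  induction k with
  | zero => simp [joinChain]
  | succ k ih =>
    rw [joinChain, bdry_cone, ← periodic_bdry, ih, map_zero, sub_zero]
    cases k with
    | zero => simp [joinChain, periodic]
    | succ k => exact periodic_periodic (by simp [add_assoc]) k _

/-- The tuples with `k` entries, all of them vertices of a simplex of the join of the first `k`
copies of `ZMod p`: a simplex picks at most one element in each copy. -/
def joinSimplices (p k : ℕ) : Set (List (ℕ × ZMod p)) :=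
  {l | l.length = k ∧ ∃ s : ℕ → ZMod p, ∀ q ∈ l, q.1 < k ∧ q.2 = s q.1}

lemma map_mem_joinSimplices {k : ℕ} (g : ZMod p) {l : List (ℕ × ZMod p)}
    (hl : l ∈ joinSimplices p k) :
    l.map (fun q => (q.1, g + q.2)) ∈ joinSimplices p k := by
  obtain ⟨hlen, s, hs⟩ := hl
  refine ⟨by simpa using hlen, fun i => g + s i, fun q hq => ?_⟩
  obtain ⟨q', hq', rfl⟩ := List.mem_map.1 hq
  exact ⟨(hs q' hq').1, by simp [(hs q' hq').2]⟩

lemma joinChain_mem_supported (k : ℕ) :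
    joinChain p k ∈ Finsupp.supported (ZMod p) (ZMod p) (joinSimplices p k) := by
  induction k with
  | zero => exact Finsupp.single_mem_supported _ _ ⟨rfl, fun _ => 0, by simp⟩
  | succ k ih =>
    refine cone_mem_supported (P := joinSimplices p k) ?_ ?_
    · rintro l ⟨hlen, s, hs⟩
      refine ⟨by simpa using hlen, Function.update s k 0, ?_⟩
      simp only [List.mem_cons, forall_eq_or_imp]
      refine ⟨by simp, fun q hq => ⟨(hs q hq).1.trans (Nat.lt_succ_self k), ?_⟩⟩
      rw [Function.update_of_ne (hs q hq).1.ne, (hs q hq).2]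
    · have hmap (g : ZMod p) := map_mem_supported (R := ZMod p)
        (fun l hl => map_mem_joinSimplices (k := k) g hl) ih
      cases k with
      | zero => exact ih
      | succ k =>
        by_cases hk : Even k
        · simpa [periodic, hk] using sub_mem (hmap 1) ih
        · simpa [periodic, hk] using sum_mem fun t _ => hmap t

/-! ### Cochains on tuples of group elements -/

/-- The cochain recording whether the representatives in `{0, …, p - 1}` decrease from `a` to
`b`. -/
def descent (a b : ZMod p) : ZMod p := if b.val < a.val then 1 else 0

/-- The coboundary of `descent`, an invariant cocycle: the Bockstein class in degree two. -/
def bockstein (a b c : ZMod p) : ZMod p := descent b c - descent a c + descent a b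

/-- The cup power of the Bockstein class, on tuples with an odd number of entries. It is `0` on the
other tuples. -/
def evenClass : List (ZMod p) → ZMod p
  | a :: b :: c :: l => bockstein a b c * evenClass (c :: l)
  | [_] => 1
  | _ => 0

/-- The cup product of the tautological one-dimensional class with a power of the Bockstein
class, on tuples with an even number of entries. -/
def oddClass : List (ZMod p) → ZMod p
  | a :: b :: l => (b - a) * evenClass (b :: l)
  | _ => 0

/-- A cochain whose coboundary is `oddClass`, and whose difference with its translate by the
generator is `evenClass`. -/
def oddPrimitive : List (ZMod p) → ZMod p
  | a :: l => a * evenClass (a :: l)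
  | _ => 0

/-- A cochain whose coboundary is `evenClass` in positive degrees, and whose norm is `oddClass`. -/
def evenPrimitive : List (ZMod p) → ZMod p
  | a :: b :: l => descent a b * evenClass (b :: l)
  | _ => 0

/-- Evaluation of a cochain on chains. -/
noncomputable def eval (F : List V → ZMod p) : Chain (ZMod p) V →ₗ[ZMod p] ZMod p :=
  Finsupp.linearCombination (ZMod p) F

@[simp] lemma eval_single (F : List V → ZMod p) (l : List V) (r : ZMod p) :
    eval F (Finsupp.single l r) = r * F l := by
  simp [eval]

lemma natCast_mul_descent (a b : ZMod p) :
    (p : ℤ) * (if b.val < a.val then 1 else 0) = (b - a).val + a.val - b.val := by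
  have h := ZMod.val_add (b - a) a
  rw [sub_add_cancel] at h
  have h1 := ZMod.val_lt (b - a)
  have h2 := ZMod.val_lt a
  have h3 := ZMod.val_lt b
  rcases lt_or_ge ((b - a).val + a.val) p with h4 | h4
  · rw [Nat.mod_eq_of_lt h4] at h
    rw [if_neg (by omega)]
    omega
  · rw [Nat.mod_eq_sub_mod h4, Nat.mod_eq_of_lt (by omega)] at h
    rw [if_pos (by omega)]
    omega

lemma bockstein_add (g a b c : ZMod p) :
    bockstein (g + a) (g + b) (g + c) = bockstein a b c := by
  have hp : (p : ℤ) ≠ 0 := by exact_mod_cast (Fact.out : p.Prime).ne_zero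
  have key (a b c : ZMod p) : bockstein a b c =
      (((if c.val < b.val then 1 else 0) - (if c.val < a.val then 1 else 0) +
        (if b.val < a.val then 1 else 0) : ℤ) : ZMod p) := by
    simp [bockstein, descent]
  rw [key, key]
  congr 1
  apply mul_left_cancel₀ hp
  simp only [mul_add, mul_sub, natCast_mul_descent, add_sub_add_left_eq_sub]
  ring

lemma sum_descent (a b : ZMod p) : ∑ t, descent (t + a) (t + b) = b - a := by
  have hp : (p : ℤ) ≠ 0 := by exact_mod_cast (Fact.out : p.Prime).ne_zero
  have hsum (x : ZMod p) : ∑ t : ZMod p, ((t + x).val : ℤ) = ∑ t : ZMod p, (t.val : ℤ) :=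
    Equiv.sum_comp (Equiv.addRight x) fun t : ZMod p => (t.val : ℤ)
  have key : ∑ t : ZMod p, (if (t + b).val < (t + a).val then (1 : ℤ) else 0) = (b - a).val := by
    apply mul_left_cancel₀ hp
    rw [Finset.mul_sum]
    simp only [natCast_mul_descent, add_sub_add_left_eq_sub, Finset.sum_sub_distrib,
      Finset.sum_add_distrib, hsum]
    simp [ZMod.card]
  have := congrArg (Int.cast : ℤ → ZMod p) key
  simpa [descent] using this

lemma evenClass_map_add (g : ZMod p) (l : List (ZMod p)) :
    evenClass (l.map (g + ·)) = evenClass l := by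
  induction l using evenClass.induct with
  | case1 a b c l ih =>
    simp only [List.map_cons] at ih
    simp [evenClass, bockstein_add, ih]
  | case2 => simp [evenClass]
  | case3 l h1 h2 =>
    rcases l with _ | ⟨a, _ | ⟨b, _ | ⟨c, l⟩⟩⟩
    · simp
    · exact absurd rfl (h2 a)
    · simp [evenClass]
    · exact absurd rfl (h1 a b c l)

lemma eval_evenClass_cone (a b c : ZMod p) (d : Chain (ZMod p) (ZMod p)) :
    eval evenClass (cone a (cone b (cone c d))) = bockstein a b c * eval evenClass (cone c d) := by
  induction d using Finsupp.induction_linear with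
  | zero => simp
  | add c d hc hd => simp only [map_add, hc, hd, mul_add]
  | single l r => simp [evenClass]; ring

lemma eval_oddPrimitive_cone (a : ZMod p) (d : Chain (ZMod p) (ZMod p)) :
    eval oddPrimitive (cone a d) = a * eval evenClass (cone a d) := by
  induction d using Finsupp.induction_linear with
  | zero => simp
  | add c d hc hd => simp only [map_add, hc, hd, mul_add]
  | single l r => simp [oddPrimitive]; ring

lemma eval_evenPrimitive_cone (a b : ZMod p) (d : Chain (ZMod p) (ZMod p)) :
    eval evenPrimitive (cone a (cone b d)) = descent a b * eval evenClass (cone b d) := by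
  induction d using Finsupp.induction_linear with
  | zero => simp
  | add c d hc hd => simp only [map_add, hc, hd, mul_add]
  | single l r => simp [evenPrimitive]; ring

/-- `evenClass` is a cocycle. -/
lemma eval_evenClass_bdryList (l : List (ZMod p)) : eval evenClass (bdryList l) = 0 := by
  induction l using evenClass.induct with
  | case1 a b c l ih =>
    rcases l with _ | ⟨d, l⟩
    · simp [bdryList, evenClass]
    · simp only [bdryList, map_sub, cone_single, eval_single, eval_evenClass_cone, evenClass]
        at ih ⊢
      simp only [bockstein, one_mul] at ih ⊢
      linear_combination (descent b c - descent a c + descent a b) * ih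
  | case2 => simp [bdryList, evenClass]
  | case3 l h1 h2 =>
    rcases l with _ | ⟨a, _ | ⟨b, _ | ⟨c, l⟩⟩⟩
    · simp [bdryList]
    · exact absurd rfl (h2 a)
    · simp [bdryList, evenClass]
    · exact absurd rfl (h1 a b c l)

lemma eval_oddPrimitive_bdry (c : Chain (ZMod p) (ZMod p)) :
    eval oddPrimitive (bdry c) = eval oddClass c := by
  refine eq_of_forall_mem (R := ZMod p) (V := ZMod p) (M := ZMod p) (P := Set.univ)
    (φ := eval oddPrimitive ∘ₗ bdry) (fun l _ => ?_)
    (by simp)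
  rw [LinearMap.comp_apply, bdry_single]
  rcases l with _ | ⟨a, _ | ⟨b, l⟩⟩
  · simp [bdryList, oddClass]
  · simp [bdryList, oddClass, oddPrimitive]
  · have h := eval_evenClass_bdryList (a :: b :: l)
    simp only [bdryList, map_sub, cone_single, eval_single, eval_oddPrimitive_cone, oddPrimitive,
      oddClass] at h ⊢
    linear_combination a * h

lemma eval_evenPrimitive_bdry {c : Chain (ZMod p) (ZMod p)}
    (hc : c ∈ Finsupp.supported (ZMod p) (ZMod p) {l : List (ZMod p) | l.length ≠ 1}) :
    eval evenPrimitive (bdry c) = eval evenClass c := by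
  refine eq_of_forall_mem (R := ZMod p) (V := ZMod p) (M := ZMod p)
    (φ := eval evenPrimitive ∘ₗ bdry) (fun l hl => ?_) hc
  rw [LinearMap.comp_apply, bdry_single]
  rcases l with _ | ⟨a, _ | ⟨b, _ | ⟨c, l⟩⟩⟩
  · simp [bdryList, evenClass]
  · simp at hl
  · simp [bdryList, evenClass, evenPrimitive]
  · have h := eval_evenClass_bdryList (b :: c :: l)
    simp only [bdryList, map_sub, cone_single, eval_single, eval_evenPrimitive_cone, evenPrimitive,
      evenClass, bockstein] at h ⊢
    linear_combination -descent a b * h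

lemma eval_oddPrimitive_periodic (c : Chain (ZMod p) (ZMod p)) :
    eval oddPrimitive (map (1 + ·) c) - eval oddPrimitive c = eval evenClass c := by
  refine eq_of_forall_mem (R := ZMod p) (V := ZMod p) (M := ZMod p) (P := Set.univ)
    (φ := eval oddPrimitive ∘ₗ map ((1 : ZMod p) + ·) - eval oddPrimitive) (fun l _ => ?_) (by simp)
  rcases l with _ | ⟨a, l⟩
  · simp [oddPrimitive, evenClass]
  · have h := evenClass_map_add 1 (a :: l)
    rw [List.map_cons] at h
    simp [oddPrimitive, h]
    ring

lemma eval_evenPrimitive_norm (c : Chain (ZMod p) (ZMod p)) :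
    ∑ t, eval evenPrimitive (map (t + ·) c) = eval oddClass c := by
  have := eq_of_forall_mem (R := ZMod p) (V := ZMod p) (M := ZMod p) (P := Set.univ) (c := c)
    (φ := ∑ t : ZMod p, eval evenPrimitive ∘ₗ map (t + ·)) (ψ := eval oddClass)
    (fun l _ => ?_) (by simp)
  · simpa using this
  rcases l with _ | ⟨a, _ | ⟨b, l⟩⟩
  · simp [evenPrimitive, oddClass]
  · simp [evenPrimitive, oddClass]
  · have h (t : ZMod p) := evenClass_map_add t (b :: l)
    simp only [List.map_cons] at h
    simp [evenPrimitive, oddClass, h, ← Finset.sum_mul, sum_descent]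

/-- The cocycle of degree `k - 1` representing the generator of the cohomology of `ZMod p`. -/
def fundClass (k : ℕ) : List (ZMod p) → ZMod p := if Even k then oddClass else evenClass

/-- The fundamental cocycles take the value `1` on all resolution chains. -/
theorem IsResolution.eval_fundClass {M : ℕ} {d : ℕ → Chain (ZMod p) (ZMod p)}
    (hd : IsResolution (· + ·) M d)
    (hlen : ∀ k, d k ∈ Finsupp.supported (ZMod p) (ZMod p) {l : List (ZMod p) | l.length = k})
    (k : ℕ) (hkM : k < M) : eval (fundClass (k + 1)) (d (k + 1)) = 1 := by
  induction k with
  | zero =>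
    have h := eq_of_forall_mem (R := ZMod p) (V := ZMod p) (M := ZMod p) (c := d 1)
      (φ := eval evenClass) (ψ := Finsupp.lapply [] ∘ₗ bdry) (fun l hl => ?_) (hlen 1)
    · simpa [fundClass, hd.succ 0 hkM, hd.zero, periodic] using h
    · obtain ⟨a, rfl⟩ := List.length_eq_one_iff.1 hl
      simp [bdry_single, bdryList, evenClass]
  | succ k ih =>
    specialize ih (by omega)
    by_cases hk : Even k
    · have hk1 : ¬ Even (k + 1) := by simpa [Nat.even_add_one] using hk
      have hk2 : Even (k + 1 + 1) := by simpa [Nat.even_add_one] using hk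
      rw [fundClass, if_neg hk1] at ih
      rw [fundClass, if_pos hk2, ← eval_oddPrimitive_bdry, hd.succ _ hkM]
      simpa [periodic, hk, ← ih] using eval_oddPrimitive_periodic (d (k + 1))
    · have hk1 : Even (k + 1) := by simpa [Nat.even_add_one] using hk
      have hk2 : ¬ Even (k + 1 + 1) := by simpa [Nat.even_add_one] using hk
      rw [fundClass, if_pos hk1] at ih
      rw [fundClass, if_neg hk2, ← eval_evenPrimitive_bdry, hd.succ _ hkM]
      · simpa [periodic, hk, ← ih] using eval_evenPrimitive_norm (d (k + 1))
      · refine supported_mono (fun l hl => ?_) (hlen (k + 1 + 1))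
        simp only [Set.mem_ofPred_eq] at hl ⊢
        omega

lemma evenClass_eq_zero {l : List (ZMod p)} (hl : ¬ l.IsChain (· ≠ ·)) : evenClass l = 0 := by
  induction l using evenClass.induct with
  | case1 a b c l ih =>
    rw [evenClass]
    by_cases hab : a = b
    · simp [bockstein, descent, hab]
    by_cases hbc : b = c
    · simp [bockstein, descent, hbc]
    · rw [ih (by simpa [hab, hbc] using hl), mul_zero]
  | case2 => simp at hl
  | case3 l h1 h2 =>
    rcases l with _ | ⟨a, _ | ⟨b, _ | ⟨c, l⟩⟩⟩
    · simp [evenClass]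
    · exact absurd rfl (h2 a)
    · simp [evenClass]
    · exact absurd rfl (h1 a b c l)

/-- The fundamental cocycles are normalized: they vanish on tuples with two equal consecutive
entries. -/
lemma fundClass_eq_zero (k : ℕ) {l : List (ZMod p)} (hl : ¬ l.IsChain (· ≠ ·)) :
    fundClass k l = 0 := by
  rw [fundClass]
  split_ifs
  · rcases l with _ | ⟨a, _ | ⟨b, l⟩⟩
    · rfl
    · rfl
    · by_cases hab : a = b
      · simp [oddClass, hab]
      · rw [oddClass, evenClass_eq_zero (by simpa [hab] using hl), mul_zero]
  · exact evenClass_eq_zero hl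

end ListChain

/-! ### Barycentric subdivision -/

namespace ListChain

section Barycenter

variable {E : Type*} [NormedAddCommGroup E] [NormedSpace ℝ E]

/-- The barycenter of the entries of a list. -/
noncomputable def barycenter (l : List E) : E := (l.length : ℝ)⁻¹ • l.sum

lemma barycenter_map {F : Type*} [NormedAddCommGroup F] [NormedSpace ℝ F] (f : E →ₗ[ℝ] F)
    (l : List E) : barycenter (l.map f) = f (barycenter l) := by
  simp [barycenter, map_list_sum]

lemma norm_sum_sub_le {v : E} {D : ℝ} {l : List E} (h : ∀ w ∈ l, dist w v ≤ D) :
    ‖l.sum - (l.length : ℝ) • v‖ ≤ l.length * D := by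
  induction l with
  | nil => simp
  | cons a l ih =>
    simp only [List.mem_cons, forall_eq_or_imp] at h
    have e : (a :: l).sum - ((a :: l).length : ℝ) • v
        = (a - v) + (l.sum - (l.length : ℝ) • v) := by
      simp only [List.sum_cons, List.length_cons, Nat.cast_add, Nat.cast_one, add_smul, one_smul]
      abel
    rw [e]
    refine (norm_add_le _ _).trans ?_
    have h1 := h.1
    rw [dist_eq_norm] at h1
    have h2 := ih h.2
    push_cast [List.length_cons]
    linarith

lemma dist_barycenter_le {D : ℝ} {l : List E} (h : ∀ v ∈ l, ∀ w ∈ l, dist v w ≤ D) {L : ℕ}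
    (hL : l.length ≤ L) {v : E} (hv : v ∈ l) :
    dist (barycenter l) v ≤ (1 - (L : ℝ)⁻¹) * D := by
  classical
  have hperm := List.perm_cons_erase hv
  set r := l.erase v with hr
  have hlen : l.length = r.length + 1 := by simpa using hperm.length_eq
  have hsum : l.sum = v + r.sum := by simpa using hperm.sum_eq
  have hD : 0 ≤ D := by simpa using h v hv v hv
  have hpos : (0 : ℝ) < r.length + 1 := by positivity
  have hbound := norm_sum_sub_le (v := v) (D := D) (l := r)
    fun w hw => h w (List.mem_of_mem_erase hw) v hv
  have e : barycenter l - v = ((r.length : ℝ) + 1)⁻¹ • (r.sum - (r.length : ℝ) • v) := by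
    rw [barycenter, hlen, hsum]
    push_cast
    rw [← sub_eq_zero]
    have : ((r.length : ℝ) + 1) • (((r.length : ℝ) + 1)⁻¹ • (v + r.sum) - v
        - ((r.length : ℝ) + 1)⁻¹ • (r.sum - (r.length : ℝ) • v)) = 0 := by
      rw [smul_sub, smul_sub, smul_inv_smul₀ hpos.ne', smul_inv_smul₀ hpos.ne', add_smul, one_smul]
      abel
    exact (smul_eq_zero.1 this).resolve_left hpos.ne'
  rw [dist_eq_norm, e, norm_smul, Real.norm_of_nonneg (by positivity)]
  have hL' : (r.length : ℝ) + 1 ≤ L := by exact_mod_cast hlen ▸ hL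
  calc ((r.length : ℝ) + 1)⁻¹ * ‖r.sum - (r.length : ℝ) • v‖
      ≤ ((r.length : ℝ) + 1)⁻¹ * (r.length * D) := by gcongr
    _ = (1 - ((r.length : ℝ) + 1)⁻¹) * D := by field_simp; ring
    _ ≤ (1 - (L : ℝ)⁻¹) * D := by gcongr

lemma barycenter_mem_convexHull {l : List E} (hl : l ≠ []) :
    barycenter l ∈ convexHull ℝ {v | v ∈ l} := by
  have hpos : (0 : ℝ) < l.length := by exact_mod_cast List.length_pos_iff.2 hl
  have key : ∀ l' : List E, l' ≠ [] → barycenter l' ∈ convexHull ℝ {v | v ∈ l'} := by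
    intro l'
    induction l' with
    | nil => simp
    | cons a r ih =>
      intro _
      rcases eq_or_ne r [] with rfl | hr
      · simp [barycenter]
      · have hr' : (0 : ℝ) < r.length := by exact_mod_cast List.length_pos_iff.2 hr
        have h1 : barycenter r ∈ convexHull ℝ {v | v ∈ a :: r} :=
          convexHull_mono (fun v hv => List.mem_cons_of_mem a hv) (ih hr)
        have h2 : a ∈ convexHull ℝ {v | v ∈ a :: r} := subset_convexHull ℝ _ List.mem_cons_self
        have h3 := (convex_convexHull ℝ {v | v ∈ a :: r}) h2 h1
          (a := ((r.length : ℝ) + 1)⁻¹) (b := r.length * ((r.length : ℝ) + 1)⁻¹)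
          (by positivity) (by positivity) (by field_simp; ring)
        convert h3 using 1
        rw [barycenter, barycenter, smul_smul]
        have : (r.length : ℝ) * ((r.length : ℝ) + 1)⁻¹ * (r.length : ℝ)⁻¹
            = ((r.length : ℝ) + 1)⁻¹ := by field_simp
        rw [this, ← smul_add]
        simp
  exact key l hl

/-- Barycentric subdivision shrinks the tuples, and keeps them in the convex hull. -/
lemma sd_barycenter_single_mem_supported {R : Type*} [CommRing R] {L : ℕ} {D : ℝ} {l : List E}
    (hL : l.length ≤ L) (hD : ∀ v ∈ l, ∀ w ∈ l, dist v w ≤ D) (k : ℕ) :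
    sd barycenter k (Finsupp.single l (1 : R)) ∈ Finsupp.supported R R
      {l' : List E | (∀ v ∈ l', v ∈ convexHull ℝ {v | v ∈ l}) ∧
        ∀ v ∈ l', ∀ w ∈ l', dist v w ≤ (1 - (L : ℝ)⁻¹) * D} := by
  have := sd_single_mem_supported (R := R) (b := barycenter)
    (Q := fun l : List E => {l' : List E | l.length ≤ L →
      (∀ v ∈ l, ∀ w ∈ l, dist v w ≤ D) → (∀ v ∈ l', v ∈ convexHull ℝ {v | v ∈ l}) ∧
        ∀ v ∈ l', ∀ w ∈ l', dist v w ≤ (1 - (L : ℝ)⁻¹) * D}) (by simp) ?_ k l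
  · refine supported_mono (fun l' hl' => ?_) this
    exact hl' hL hD
  intro l l' l'' hsub hlen hl'' hL hD
  obtain ⟨hull, hdist⟩ := hl'' (by omega)
    fun v hv w hw => hD v (hsub.subset hv) w (hsub.subset hw)
  have hne : l ≠ [] := by rintro rfl; simp at hlen
  have hull' : ∀ v ∈ l'', v ∈ convexHull ℝ {v | v ∈ l} := fun v hv =>
    convexHull_mono (fun w hw => hsub.subset hw) (hull v hv)
  have hb : ∀ v ∈ convexHull ℝ {v | v ∈ l}, dist (barycenter l) v ≤ (1 - (L : ℝ)⁻¹) * D := by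
    intro v hv
    have : convexHull ℝ {v | v ∈ l} ⊆ Metric.closedBall (barycenter l) ((1 - (L : ℝ)⁻¹) * D) :=
      convexHull_min (fun w hw => by
        rw [Metric.mem_closedBall, dist_comm]; exact dist_barycenter_le hD hL hw)
        (convex_closedBall _ _)
    rw [dist_comm]
    exact this hv
  have hself := barycenter_mem_convexHull hne
  refine ⟨?_, ?_⟩
  · simpa only [List.mem_cons, forall_eq_or_imp] using ⟨hself, hull'⟩
  · simp only [List.mem_cons, forall_eq_or_imp]
    exact ⟨⟨hb _ hself, fun v hv => hb v (hull' v hv)⟩, fun v hv =>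
      ⟨by rw [dist_comm]; exact hb v (hull' v hv), hdist v hv⟩⟩

/-- Resolution chains of tuples lying in convex cells can be made arbitrarily fine. -/
lemma IsResolution.exists_fine {p : ℕ} [Fact p.Prime] {τ : ZMod p → E →ₗ[ℝ] E} {M : ℕ}
    {d : ℕ → Chain (ZMod p) E} (hd : IsResolution (fun g => τ g) M d) {𝒞 : Set (Set E)}
    (hconv : ∀ C ∈ 𝒞, Convex ℝ C) {D : ℝ}
    (hsupp : ∀ k ≤ M, d k ∈ Finsupp.supported (ZMod p) (ZMod p)
      {l : List E | l.length ≤ M ∧ (∃ C ∈ 𝒞, ∀ v ∈ l, v ∈ C) ∧ ∀ v ∈ l, ∀ w ∈ l, dist v w ≤ D})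
    {ε : ℝ} (hε : 0 < ε) :
    ∃ d' : ℕ → Chain (ZMod p) E, IsResolution (fun g => τ g) M d' ∧
      ∀ k ≤ M, d' k ∈ Finsupp.supported (ZMod p) (ZMod p)
        {l : List E | (∃ C ∈ 𝒞, ∀ v ∈ l, v ∈ C) ∧ ∀ v ∈ l, ∀ w ∈ l, dist v w ≤ ε} := by
  set θ : ℝ := 1 - ((M + 1 : ℕ) : ℝ)⁻¹ with hθ
  have hθ0 : 0 ≤ θ := by
    have : ((M + 1 : ℕ) : ℝ)⁻¹ ≤ 1 := inv_le_one_of_one_le₀ (by simp)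
    linarith
  have hθ1 : θ < 1 := by
    have : 0 < ((M + 1 : ℕ) : ℝ)⁻¹ := by positivity
    linarith
  have key : ∀ N : ℕ, ∃ d' : ℕ → Chain (ZMod p) E, IsResolution (fun g => τ g) M d' ∧
      ∀ k ≤ M, d' k ∈ Finsupp.supported (ZMod p) (ZMod p)
        {l : List E | l.length ≤ M ∧ (∃ C ∈ 𝒞, ∀ v ∈ l, v ∈ C) ∧
          ∀ v ∈ l, ∀ w ∈ l, dist v w ≤ θ ^ N * D} := by
    intro N
    induction N with
    | zero => exact ⟨d, hd, by simpa using hsupp⟩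
    | succ N ih =>
      obtain ⟨d', hd', hsupp'⟩ := ih
      refine ⟨fun k => sd barycenter k (d' k), hd'.push (sd barycenter) (sd_zero_nil _)
        (bdry_sd _) fun k _ g => (map_sd (fun l _ => barycenter_map (τ g) l) k _).symm,
        fun k hk => ?_⟩
      have h1 := supported_mono (Q := {l : List E | l.length ≤ M})
        (fun l hl => (hl : l.length = k).le.trans hk)
        (sd_mem_supported_length barycenter k (d' k))
      refine mem_supported_inter h1 (mem_supported_of_forall (fun l hl => ?_) (hsupp' k hk))
      obtain ⟨hlen, ⟨C, hC, hlC⟩, hdist⟩ := hl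
      refine supported_mono (fun l' hl' => ?_)
        (sd_barycenter_single_mem_supported (hlen.trans M.le_succ) hdist k)
      refine ⟨⟨C, hC, fun v hv => convexHull_min hlC (hconv C hC) (hl'.1 v hv)⟩, ?_⟩
      rw [pow_succ, mul_right_comm, mul_comm]
      exact hl'.2
  have hlim : Filter.Tendsto (fun N : ℕ => θ ^ N * D) Filter.atTop (nhds 0) := by
    simpa using (tendsto_pow_atTop_nhds_zero_of_lt_one hθ0 hθ1).mul_const D
  obtain ⟨N, hN⟩ := (hlim.eventually (eventually_lt_nhds hε)).exists
  obtain ⟨d', hd', hsupp'⟩ := key N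
  refine ⟨d', hd', fun k hk => supported_mono (fun l hl => ?_) (hsupp' k hk)⟩
  exact ⟨hl.2.1, fun v hv w hw => (hl.2.2 v hv w hw).trans hN.le⟩

end Barycenter

/-! ### Subdivision along colours -/

section Colour

variable {p : ℕ}

/-- An entry of the list whose first component, its colour, is largest. -/
def topVertex : List (ℕ × ZMod p) → ℕ × ZMod p
  | [] => (0, 0)
  | [a] => a
  | a :: b :: l => if (topVertex (b :: l)).1 ≤ a.1 then a else topVertex (b :: l)

lemma topVertex_mem {l : List (ℕ × ZMod p)} (hl : l ≠ []) : topVertex l ∈ l := by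
  induction l using topVertex.induct with
  | case1 => exact absurd rfl hl
  | case2 a => simp [topVertex]
  | case3 a b l h ih => simp [topVertex, h]
  | case4 a b l h ih2 =>
    rw [topVertex, if_neg h]
    exact List.mem_cons_of_mem _ (ih2 (by simp))

lemma le_topVertex {l : List (ℕ × ZMod p)} {q : ℕ × ZMod p} (hq : q ∈ l) :
    q.1 ≤ (topVertex l).1 := by
  induction l using topVertex.induct with
  | case1 => simp at hq
  | case2 a => simp at hq; simp [topVertex, hq]
  | case3 a b l h ih =>
    rw [topVertex, if_pos h]
    rcases List.mem_cons.1 hq with rfl | hq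
    · rfl
    · exact (ih hq).trans h
  | case4 a b l h ih2 =>
    rw [topVertex, if_neg h]
    rcases List.mem_cons.1 hq with rfl | hq
    · omega
    · exact ih2 hq

lemma topVertex_map (g : ZMod p) {l : List (ℕ × ZMod p)} (hl : l ≠ []) :
    topVertex (l.map fun q => (q.1, g + q.2)) = ((topVertex l).1, g + (topVertex l).2) := by
  induction l using topVertex.induct with
  | case1 => exact absurd rfl hl
  | case2 a => simp [topVertex]
  | case3 a b l h ih =>
    have ih := ih (by simp)
    simp only [List.map_cons] at ih ⊢
    simp [topVertex, ih, h]
  | case4 a b l h ih2 =>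
    have ih := ih2 (by simp)
    simp only [List.map_cons] at ih ⊢
    simp [topVertex, ih, h]

/-- Subdividing with the top vertices yields tuples along which the colours decrease. -/
lemma sd_topVertex_single_mem_supported {R : Type*} [CommRing R] (k : ℕ)
    (l : List (ℕ × ZMod p)) :
    sd topVertex k (Finsupp.single l (1 : R)) ∈ Finsupp.supported R R
      {l' : List (ℕ × ZMod p) | (∀ q ∈ l', q ∈ l) ∧ l'.Pairwise fun q r => r.1 ≤ q.1} := by
  refine sd_single_mem_supported (R := R) (b := topVertex) (Q := fun l : List (ℕ × ZMod p) =>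
    {l' : List (ℕ × ZMod p) | (∀ q ∈ l', q ∈ l) ∧ l'.Pairwise fun q r => r.1 ≤ q.1})
    (by simp) ?_ k l
  rintro l l' l'' hsub hlen ⟨hmem, hpair⟩
  have hne : l ≠ [] := by rintro rfl; simp at hlen
  have hmem' : ∀ q ∈ l'', q ∈ l := fun q hq => hsub.subset (hmem q hq)
  refine ⟨?_, List.pairwise_cons.2 ⟨fun q hq => le_topVertex (hmem' q hq), hpair⟩⟩
  simpa only [List.mem_cons, forall_eq_or_imp] using ⟨topVertex_mem hne, hmem'⟩

lemma pairwise_lt_of_isChain_ne {l : List (ℕ × ZMod p)}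
    (hinj : ∀ q ∈ l, ∀ r ∈ l, q.1 = r.1 → q = r) (hpair : l.Pairwise fun q r => r.1 ≤ q.1)
    (hne : (l.map Prod.snd).IsChain (· ≠ ·)) : l.Pairwise fun q r => r.1 < q.1 := by
  induction l with
  | nil => simp
  | cons a l ih =>
    rw [List.pairwise_cons] at hpair ⊢
    refine ⟨?_, ih (fun q hq r hr => hinj q (List.mem_cons_of_mem _ hq) r
      (List.mem_cons_of_mem _ hr)) hpair.2 (List.IsChain.tail hne)⟩
    rcases l with _ | ⟨b, l⟩
    · simp
    · have hab : b.1 < a.1 := by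
        refine lt_of_le_of_ne (hpair.1 b (by simp)) fun h => ?_
        have := hinj b (by simp) a (by simp) h
        simp [this] at hne
      intro q hq
      rcases List.mem_cons.1 hq with rfl | hq
      · exact hab
      · exact ((List.pairwise_cons.1 hpair.2).1 q hq).trans_lt hab

/-- The fundamental cocycle of degree `m + 1` vanishes on the chains of tuples whose labels span
simplices of dimension at most `m`, with distinct colours in each simplex. -/
lemma eval_fundClass_sd_topVertex_eq_zero [Fact p.Prime] {m : ℕ}
    {c : Chain (ZMod p) (ℕ × ZMod p)}
    (hc : c ∈ Finsupp.supported (ZMod p) (ZMod p) {l : List (ℕ × ZMod p) |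
      ∃ S : Finset (ℕ × ZMod p), S.card ≤ m + 1 ∧ (∀ q ∈ S, ∀ r ∈ S, q.1 = r.1 → q = r) ∧
        ∀ q ∈ l, q ∈ S}) :
    eval (fundClass (m + 2)) (map Prod.snd (sd topVertex (m + 2) c)) = 0 := by
  have h := eq_of_forall_mem (R := ZMod p) (V := ℕ × ZMod p) (M := ZMod p)
    (φ := eval (fundClass (m + 2)) ∘ₗ map Prod.snd ∘ₗ sd topVertex (m + 2)) (ψ := 0)
    (fun l hl => ?_) hc
  · simpa using h
  obtain ⟨S, hcard, hinj, hS⟩ := hl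
  have h := eq_of_forall_mem (R := ZMod p) (V := ℕ × ZMod p) (M := ZMod p)
    (φ := eval (fundClass (m + 2)) ∘ₗ map Prod.snd) (ψ := 0) (fun l' hl' => ?_)
    (mem_supported_inter (sd_topVertex_single_mem_supported (R := ZMod p) (m + 2) l)
      (sd_mem_supported_length topVertex (m + 2) _))
  · simpa using h
  obtain ⟨⟨hmem, hpair⟩, hlen⟩ := hl'
  rw [LinearMap.comp_apply, map_single, eval_single, fundClass_eq_zero, mul_zero]
  · rfl
  intro hne
  have hpair' := pairwise_lt_of_isChain_ne
    (fun q hq r hr => hinj q (hS q (hmem q hq)) r (hS r (hmem r hr))) hpair hne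
  have hnodup : l'.Nodup := hpair'.imp fun {q r} h => by rintro rfl; exact lt_irrefl _ h
  have := Finset.card_le_card (s := l'.toFinset) (t := S)
    fun q hq => hS q (hmem q (List.mem_toFinset.1 hq))
  rw [List.toFinset_card_of_nodup hnodup] at this
  simp only [Set.mem_ofPred_eq] at hlen
  omega

end Colour

end ListChain

/-! ### Maps avoiding the origin -/

namespace FreeSphere

open Metric

/-- The condition that every continuous map from `X` to `ℝ ^ (n + 1)` can be approximated uniformly
by maps without zeros. For compact metric spaces it says that the covering dimension is at
most `n`. -/
def AvoidsZero (X : Type*) [TopologicalSpace X] (n : ℕ) : Prop :=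
  ∀ φ : C(X, EuclideanSpace ℝ (Fin (n + 1))), ∀ ε > 0,
    ∃ ψ : C(X, EuclideanSpace ℝ (Fin (n + 1))), (∀ x, dist (ψ x) (φ x) < ε) ∧ ∀ x, ψ x ≠ 0

/-- A smooth approximation takes a set of Hausdorff dimension less than `n + 1` to a null set, so
that a small translation moves the image off the origin. -/
theorem avoidsZero_of_dimH_lt {E : Type*} [NormedAddCommGroup E] [NormedSpace ℝ E]
    [FiniteDimensional ℝ E] {K : Set E} (hK : IsClosed K) {n : ℕ} (hdim : dimH K < (n + 1 : ℕ)) :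
    AvoidsZero K n := by
  intro φ ε hε
  have : TietzeExtension.{_, 0} (EuclideanSpace ℝ (Fin (n + 1))) := TietzeExtension.of_tvs ℝ
  obtain ⟨F, hF⟩ := φ.exists_restrict_eq hK
  obtain ⟨P, hP, hPF, -⟩ := F.continuous.exists_contDiff_approx (ε := fun _ => ε / 2) 1
    continuous_const (fun _ => half_pos hε)
  have hdense : Dense (P '' K)ᶜ :=
    hP.contDiffOn.dense_compl_image_of_dimH_lt_finrank convex_univ (Set.subset_univ K)
      (by simpa using hdim)
  obtain ⟨c, hc, hcε⟩ := hdense.exists_dist_lt 0 (half_pos hε)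
  refine ⟨⟨fun x => P x - c, by have := hP.continuous; fun_prop⟩, fun x => ?_, fun x hx => ?_⟩
  · have h1 : φ x = F x := by rw [← hF]; rfl
    rw [h1]
    calc dist (P x - c) (F x) ≤ dist (P x - c) (P x) + dist (P x) (F x) := dist_triangle _ _ _
      _ < ε / 2 + ε / 2 := by
        refine add_lt_add ?_ (hPF x)
        simpa [dist_eq_norm] using hcε
      _ = ε := add_halves ε
  · exact hc ⟨x, x.2, sub_eq_zero.1 hx⟩

/-- The unit sphere of dimension `m`. -/
abbrev Sph (m : ℕ) := sphere (0 : EuclideanSpace ℝ (Fin (m + 1))) 1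

lemma exists_mem_sphere (m : ℕ) : ∃ v : EuclideanSpace ℝ (Fin (m + 1)), ‖v‖ = 1 :=
  ⟨EuclideanSpace.single 0 1, by simp⟩

instance (m : ℕ) : Nonempty (Sph m) :=
  let ⟨v, hv⟩ := exists_mem_sphere m
  ⟨⟨v, by simpa using hv⟩⟩

lemma dimH_sphere_le (m : ℕ) : dimH (sphere (0 : EuclideanSpace ℝ (Fin (m + 1))) 1) ≤ m := by
  obtain ⟨v, hv⟩ := exists_mem_sphere m
  have hsub : sphere (0 : EuclideanSpace ℝ (Fin (m + 1))) 1 ⊆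
      {v} ∪ Set.range (stereoInvFunAux v ∘ ((↑) : (ℝ ∙ v)ᗮ → EuclideanSpace ℝ (Fin (m + 1)))) := by
    intro x hx
    rcases eq_or_ne x v with rfl | hne
    · simp
    · right
      refine ⟨stereoToFun v x, ?_⟩
      have := stereo_left_inv hv (x := ⟨x, hx⟩) hne
      exact congrArg Subtype.val this
  have hfin : Module.finrank ℝ (ℝ ∙ v)ᗮ = m := by
    have : Fact (Module.finrank ℝ (EuclideanSpace ℝ (Fin (m + 1))) = m + 1) := ⟨by simp⟩
    exact Submodule.finrank_orthogonal_span_singleton (by rintro rfl; simp at hv)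
  refine (dimH_mono hsub).trans ?_
  rw [dimH_union, dimH_singleton]
  refine max_le zero_le ?_
  have h : ContDiff ℝ 1 (stereoInvFunAux v ∘ ((↑) : (ℝ ∙ v)ᗮ → EuclideanSpace ℝ (Fin (m + 1)))) :=
    contDiff_stereoInvFunAux.comp (ℝ ∙ v)ᗮ.subtypeL.contDiff
  simpa [hfin] using h.dimH_range_le

lemma avoidsZero_sphere (m : ℕ) : AvoidsZero (Sph m) m :=
  avoidsZero_of_dimH_lt isClosed_sphere
    ((dimH_sphere_le m).trans_lt (by exact_mod_cast Nat.lt_succ_self m))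

/-! ### Extension of maps to spheres -/

/-- Maps to the `n`-sphere extend from closed subsets of a space of dimension at most `n`: extend
to a map to `ℝ ^ (n + 1)`, and modify the extension near its zeros only. -/
theorem AvoidsZero.exists_extension {X : Type*} [TopologicalSpace X] [NormalSpace X] {n : ℕ}
    (hX : AvoidsZero X n) {A : Set X} (hA : IsClosed A) {φ : X → Sph n} (hφ : ContinuousOn φ A) :
    ∃ ψ : X → Sph n, Continuous ψ ∧ Set.EqOn ψ φ A := by
  have : TietzeExtension.{_, 0} (EuclideanSpace ℝ (Fin (n + 1))) := TietzeExtension.of_tvs ℝ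
  obtain ⟨F, hF⟩ := ContinuousMap.exists_restrict_eq hA
    (⟨fun x : A => (φ x : EuclideanSpace ℝ (Fin (n + 1))),
      continuous_subtype_val.comp (continuousOn_iff_continuous_domRestrict.1 hφ)⟩ :
      C(A, EuclideanSpace ℝ (Fin (n + 1))))
  have hFA : ∀ x ∈ A, F x = φ x := fun x hx => congrArg (fun h => h ⟨x, hx⟩) hF
  obtain ⟨Q, hQF, hQ⟩ := hX F (1 / 2) (by norm_num)
  -- The cutoff equals `1` where `F` is small and vanishes where `F` has norm at least `1`.
  let cut : X → ℝ := fun x => max 0 (min 1 (2 - 2 * ‖F x‖))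
  let H : X → EuclideanSpace ℝ (Fin (n + 1)) := fun x => F x + cut x • (Q x - F x)
  have hH : Continuous H := by fun_prop
  have hH0 : ∀ x, H x ≠ 0 := by
    intro x
    rcases le_or_gt ‖F x‖ (1 / 2) with h | h
    · have : cut x = 1 := by
        simp only [cut]
        rw [min_eq_left (by linarith), max_eq_right zero_le_one]
      simpa [H, this] using hQ x
    · intro h0
      have h1 : F x = -(cut x • (Q x - F x)) := eq_neg_of_add_eq_zero_left h0
      have h2 : ‖F x‖ ≤ ‖Q x - F x‖ := by
        rw [h1, norm_neg, norm_smul, Real.norm_of_nonneg (le_max_left _ _), ← h1]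
        exact mul_le_of_le_one_left (norm_nonneg _)
          (max_le zero_le_one (min_le_left _ _))
      have h3 := hQF x
      rw [dist_eq_norm] at h3
      linarith
  refine ⟨fun x => ⟨‖H x‖⁻¹ • H x, by simp [norm_smul, hH0 x]⟩, ?_, fun x hx => ?_⟩
  · exact (Continuous.smul (hH.norm.inv₀ fun x => norm_ne_zero_iff.2 (hH0 x)) hH).subtype_mk _
  · have h1 : ‖F x‖ = 1 := by rw [hFA x hx]; simp
    have h2 : H x = F x := by simp [H, cut, h1]
    exact Subtype.ext (by simp [h2, hFA x hx])

section Action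

variable {p : ℕ} [Fact p.Prime] {X : Type*} [MetricSpace X] [CompactSpace X]
  [AddAction (ZMod p) X] [ContinuousConstVAdd (ZMod p) X]

omit [CompactSpace X] in
lemma exists_closedBall_disjoint (hfree : ∀ (g : ZMod p) (x : X), g +ᵥ x = x → g = 0) (x : X) :
    ∃ r > 0, ∀ y ∈ closedBall x r, ∀ g : ZMod p, g ≠ 0 → g +ᵥ y ∉ closedBall x r := by
  have h : ∀ᶠ z : X × X in nhds (x, x), ∀ g : ZMod p, g ≠ 0 → g +ᵥ z.1 ≠ z.2 := by
    refine Filter.eventually_all.2 fun g => ?_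
    by_cases hg : g = 0
    · simp [hg]
    · have hopen : IsOpen {z : X × X | g +ᵥ z.1 ≠ z.2} :=
        isOpen_ne_fun (continuous_fst.const_vadd g) continuous_snd
      filter_upwards [hopen.mem_nhds (show g +ᵥ x ≠ x from fun h => hg (hfree g x h))] with z hz _
      exact hz
  obtain ⟨r, hr, hball⟩ := Metric.nhds_basis_closedBall.mem_iff.1 h
  refine ⟨r, hr, fun y hy g hg hgy => ?_⟩
  exact hball (show (y, g +ᵥ y) ∈ closedBall (x, x) r by
    rw [← closedBall_prod_same]; exact ⟨hy, hgy⟩) g hg rfl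

/-- A compact space with a free action is covered by finitely many small balls that are disjoint
from their translates. -/
lemma exists_finite_cover (hfree : ∀ (g : ZMod p) (x : X), g +ᵥ x = x → g = 0) :
    ∃ (N : ℕ) (c : Fin N → X) (r : Fin N → ℝ), (∀ x, ∃ i, x ∈ ball (c i) (r i)) ∧
      ∀ i, ∀ y ∈ closedBall (c i) (r i), ∀ g : ZMod p, g ≠ 0 → g +ᵥ y ∉ closedBall (c i) (r i) := by
  choose r hr hdisj using exists_closedBall_disjoint hfree
  obtain ⟨t, ht⟩ := isCompact_univ.elim_finite_subcover (fun x : X => ball x (r x))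
    (fun _ => isOpen_ball) fun x _ => Set.mem_iUnion.2 ⟨x, mem_ball_self (hr x)⟩
  refine ⟨t.card, fun i => t.equivFin.symm i, fun i => r (t.equivFin.symm i), fun x => ?_,
    fun i => hdisj _⟩
  obtain ⟨y, hy, hxy⟩ := Set.mem_iUnion₂.1 (ht (Set.mem_univ x))
  exact ⟨t.equivFin ⟨y, hy⟩, by simpa using hxy⟩

omit [CompactSpace X] in
/-- Extension of an equivariant map from a closed invariant set `A` over the translates of a closed
set `B` that is disjoint from its translates. -/
lemma exists_equivariant_extension_step {n : ℕ} [AddAction (ZMod p) (Sph n)]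
    [ContinuousConstVAdd (ZMod p) (Sph n)] (hX : AvoidsZero X n) {A B : Set X}
    (hA : IsClosed A) (hAinv : ∀ (g : ZMod p), ∀ x ∈ A, g +ᵥ x ∈ A) (hB : IsClosed B)
    (hBdisj : ∀ y ∈ B, ∀ g : ZMod p, g ≠ 0 → g +ᵥ y ∉ B) {φ : X → Sph n} (hφ : ContinuousOn φ A)
    (hequiv : ∀ (g : ZMod p), ∀ x ∈ A, φ (g +ᵥ x) = g +ᵥ φ x) :
    ∃ φ' : X → Sph n, ContinuousOn φ' (A ∪ {x | ∃ g : ZMod p, g +ᵥ x ∈ B}) ∧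
      ∀ (g : ZMod p), ∀ x ∈ A ∪ {x | ∃ g : ZMod p, g +ᵥ x ∈ B}, φ' (g +ᵥ x) = g +ᵥ φ' x := by
  classical
  obtain ⟨ψ, hψ, hψφ⟩ := hX.exists_extension (hA.inter hB) (hφ.mono Set.inter_subset_left)
  let φ' : X → Sph n := fun x =>
    if x ∈ A then φ x else if h : ∃ g : ZMod p, g +ᵥ x ∈ B then -h.choose +ᵥ ψ (h.choose +ᵥ x)
      else φ x
  have huniq : ∀ x (g h : ZMod p), g +ᵥ x ∈ B → h +ᵥ x ∈ B → g = h := by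
    intro x g h hg hh
    by_contra hne
    refine hBdisj _ hg (h - g) (sub_ne_zero.2 (Ne.symm hne)) ?_
    rwa [vadd_vadd, sub_add_cancel]
  have h1 : ∀ x ∈ A, φ' x = φ x := fun x hx => if_pos hx
  have h2 : ∀ x (g : ZMod p), g +ᵥ x ∈ B → φ' x = -g +ᵥ ψ (g +ᵥ x) := by
    intro x g hg
    by_cases hx : x ∈ A
    · rw [h1 x hx, hψφ ⟨hAinv g x hx, hg⟩, hequiv g x hx, neg_vadd_vadd]
    · have h : ∃ g : ZMod p, g +ᵥ x ∈ B := ⟨g, hg⟩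
      simp only [φ', if_neg hx, dif_pos h]
      rw [huniq x _ g h.choose_spec hg]
  refine ⟨φ', ?_, ?_⟩
  · have hclosed (g : ZMod p) : IsClosed {x : X | g +ᵥ x ∈ B} :=
      hB.preimage (continuous_const_vadd g)
    have hset : {x : X | ∃ g : ZMod p, g +ᵥ x ∈ B} = ⋃ g : ZMod p, {x | g +ᵥ x ∈ B} := by
      ext; simp
    rw [hset]
    refine (hφ.congr h1).union_of_isClosed ?_ hA (isClosed_iUnion_of_finite hclosed)
    refine (locallyFinite_of_finite _).continuousOn_iUnion hclosed fun g => ?_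
    refine ContinuousOn.congr (f := fun x => -g +ᵥ ψ (g +ᵥ x)) ?_ fun x hx => h2 x g hx
    exact ((hψ.comp (continuous_const_vadd g)).const_vadd (-g)).continuousOn
  · rintro g x (hx | ⟨h, hh⟩)
    · rw [h1 x hx, h1 _ (hAinv g x hx), hequiv g x hx]
    · have hh' : (h - g) +ᵥ (g +ᵥ x) ∈ B := by rwa [vadd_vadd, sub_add_cancel]
      rw [h2 x h hh, h2 _ _ hh', vadd_vadd, vadd_vadd, sub_add_cancel, neg_sub, sub_eq_add_neg]

/-- A free compact space of dimension at most `n` has an equivariant map to the `n`-sphere, for any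
action on the sphere. -/
theorem AvoidsZero.exists_equivariant {n : ℕ} [AddAction (ZMod p) (Sph n)]
    [ContinuousConstVAdd (ZMod p) (Sph n)] (hX : AvoidsZero X n)
    (hfree : ∀ (g : ZMod p) (x : X), g +ᵥ x = x → g = 0) :
    ∃ φ : X → Sph n, Continuous φ ∧ ∀ (g : ZMod p) x, φ (g +ᵥ x) = g +ᵥ φ x := by
  obtain ⟨N, c, r, hcover, hdisj⟩ := exists_finite_cover hfree
  have key : ∀ s : Finset (Fin N), ∃ φ : X → Sph n,
      ContinuousOn φ {x | ∃ i ∈ s, ∃ g : ZMod p, g +ᵥ x ∈ closedBall (c i) (r i)} ∧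
      ∀ (g : ZMod p), ∀ x ∈ {x | ∃ i ∈ s, ∃ g : ZMod p, g +ᵥ x ∈ closedBall (c i) (r i)},
        φ (g +ᵥ x) = g +ᵥ φ x := by
    intro s
    induction s using Finset.induction_on with
    | empty => exact ⟨fun _ => Classical.arbitrary _, by simp, by simp⟩
    | insert i s _ ih =>
      obtain ⟨φ, hφ, hequiv⟩ := ih
      have hset : {x | ∃ j ∈ insert i s, ∃ g : ZMod p, g +ᵥ x ∈ closedBall (c j) (r j)} =
          {x | ∃ j ∈ s, ∃ g : ZMod p, g +ᵥ x ∈ closedBall (c j) (r j)} ∪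
            {x | ∃ g : ZMod p, g +ᵥ x ∈ closedBall (c i) (r i)} := by
        ext x
        simp [or_comm]
      rw [hset]
      refine exists_equivariant_extension_step hX ?_ ?_ isClosed_closedBall (hdisj i) hφ hequiv
      · have : {x | ∃ j ∈ s, ∃ g : ZMod p, g +ᵥ x ∈ closedBall (c j) (r j)} =
            ⋃ j ∈ s, ⋃ g : ZMod p, {x | g +ᵥ x ∈ closedBall (c j) (r j)} := by
          ext x
          simp
        rw [this]
        exact isClosed_biUnion_finset fun j _ => isClosed_iUnion_of_finite fun g =>
          isClosed_closedBall.preimage (continuous_const_vadd g)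
      · rintro g x ⟨j, hj, h, hh⟩
        exact ⟨j, hj, h - g, by rwa [vadd_vadd, sub_add_cancel]⟩
  obtain ⟨φ, hφ, hequiv⟩ := key Finset.univ
  have huniv : {x | ∃ i ∈ Finset.univ, ∃ g : ZMod p, g +ᵥ x ∈ closedBall (c i) (r i)} =
      Set.univ := by
    refine Set.eq_univ_of_forall fun x => ?_
    obtain ⟨i, hi⟩ := hcover x
    exact ⟨i, Finset.mem_univ i, 0, by simpa using ball_subset_closedBall hi⟩
  rw [huniv] at hφ hequiv
  exact ⟨φ, continuousOn_univ.1 hφ, fun g x => hequiv g x (Set.mem_univ x)⟩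

end Action

end FreeSphere

/-! ### Labellings of low-dimensional free spaces -/

namespace FreeSphere

open Metric

section Labelling

variable {p : ℕ} {X : Type*} [MetricSpace X] [CompactSpace X]
  [AddAction (ZMod p) X] {N m : ℕ}

/-- The translates of the functions `u j`, indexed by the pairs `(j, g)`. -/
def translate (u : Fin N → C(X, ℝ)) (s : Fin N × ZMod p) (x : X) : ℝ := u s.1 (-s.2 +ᵥ x)

/-- The translate with index `s` attains the maximum of all translates at `x`. -/
def IsTop (u : Fin N → C(X, ℝ)) (x : X) (s : Fin N × ZMod p) : Prop :=
  ∀ i : Fin N × ZMod p, translate u i x ≤ translate u s x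

omit [CompactSpace X] in
lemma isTop_vadd_iff (u : Fin N → C(X, ℝ)) (g : ZMod p) (x : X) (s : Fin N × ZMod p) :
    IsTop u (g +ᵥ x) (s.1, g + s.2) ↔ IsTop u x s := by
  have key : ∀ s : Fin N × ZMod p, translate u (s.1, g + s.2) (g +ᵥ x) = translate u s x := by
    intro s
    simp only [translate, vadd_vadd]
    congr 2
    abel
  constructor
  · intro h i
    have := h (i.1, g + i.2)
    rwa [key, key] at this
  · intro h i
    have := h (i.1, -g + i.2)
    rw [← key, ← key] at this
    simpa using this

variable [ContinuousConstVAdd (ZMod p) X]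

lemma isOpen_setOf_forall_not_isTop (P : Set (Fin N × ZMod p)) :
    IsOpen {u : Fin N → C(X, ℝ) | ∀ x, ¬ ∀ s ∈ P, IsTop u x s} := by
  have hclosed : IsClosed {z : (Fin N → C(X, ℝ)) × X | ∀ s ∈ P, IsTop z.1 z.2 s} := by
    have hcont (s : Fin N × ZMod p) :
        Continuous fun z : (Fin N → C(X, ℝ)) × X => translate z.1 s z.2 := by
      have h1 : Continuous fun z : (Fin N → C(X, ℝ)) × X => z.1 s.1 := by fun_prop
      have h2 : Continuous fun z : (Fin N → C(X, ℝ)) × X => -s.2 +ᵥ z.2 :=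
        continuous_snd.const_vadd _
      exact h1.eval h2
    simp only [IsTop, Set.ofPred_forall]
    exact isClosed_biInter fun s _ => isClosed_iInter fun i =>
      isClosed_le (hcont i) (hcont s)
  convert (isClosedMap_fst_of_compactSpace _ hclosed).isOpen_compl using 1
  ext u
  simp

/-- Generically, no `m + 2` of the translates, belonging to distinct functions, attain the maximum
simultaneously: this amounts to `m + 1` equations on a space of dimension at most `m`. -/
lemma dense_setOf_forall_not_isTop (hX : AvoidsZero X m) {T : Fin (m + 2) → Fin N × ZMod p}
    (hT : Function.Injective fun a => (T a).1) :
    Dense {u : Fin N → C(X, ℝ) | ∀ x, ¬ ∀ s ∈ Set.range T, IsTop u x s} := by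
  classical
  have htrans (u : Fin N → C(X, ℝ)) (s : Fin N × ZMod p) : Continuous (translate u s) :=
    (u s.1).continuous.comp (continuous_const_vadd _)
  refine Metric.dense_iff.2 fun u ε hε => ?_
  let φ : C(X, EuclideanSpace ℝ (Fin (m + 1))) :=
    ⟨fun x => WithLp.toLp 2 fun a : Fin (m + 1) => translate u (T a.succ) x - translate u (T 0) x,
      (PiLp.continuous_toLp 2 _).comp
        (continuous_pi fun a => (htrans u _).sub (htrans u _))⟩
  obtain ⟨ψ, hψφ, hψ⟩ := hX φ (ε / 2) (half_pos hε)
  have hcoord (a : Fin (m + 1)) (x : X) : |ψ x a - φ x a| ≤ ε / 2 := by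
    have h1 := hψφ x
    rw [dist_eq_norm] at h1
    have h2 := PiLp.norm_apply_le (ψ x - φ x) a
    rw [Real.norm_eq_abs] at h2
    exact h2.trans h1.le
  -- The functions are modified so that the differences `φ` of their translates become `ψ`. Since
  -- the `T a` belong to distinct functions, the modifications do not interfere.
  let u' : Fin N → C(X, ℝ) := fun j =>
    if h : ∃ a : Fin (m + 1), (T a.succ).1 = j then
      u j + ⟨fun x => ψ ((T h.choose.succ).2 +ᵥ x) h.choose - φ ((T h.choose.succ).2 +ᵥ x) h.choose,
        by
          have h1 := continuous_const_vadd (T h.choose.succ).2 (T := X)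
          have h2 := ψ.continuous.comp h1
          have h3 := φ.continuous.comp h1
          exact ((EuclideanSpace.proj h.choose).continuous.comp h2).sub
            ((EuclideanSpace.proj h.choose).continuous.comp h3)⟩
    else u j
  have hu' (a : Fin (m + 1)) (x : X) : u' (T a.succ).1 x =
      u (T a.succ).1 x + (ψ ((T a.succ).2 +ᵥ x) a - φ ((T a.succ).2 +ᵥ x) a) := by
    have h : ∃ b : Fin (m + 1), (T b.succ).1 = (T a.succ).1 := ⟨a, rfl⟩
    have ha : h.choose = a := Fin.succ_injective _ (hT h.choose_spec)
    simp only [u', dif_pos h, ContinuousMap.add_apply, ContinuousMap.coe_mk, ha]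
  have hu'0 : u' (T 0).1 = u (T 0).1 := by
    refine dif_neg ?_
    rintro ⟨a, ha⟩
    exact Fin.succ_ne_zero a (hT ha)
  refine ⟨u', ?_, fun x hx => hψ x ?_⟩
  · rw [mem_ball]
    refine lt_of_le_of_lt ((dist_pi_le_iff (half_pos hε).le).2 fun j => ?_) (half_lt_self hε)
    refine (ContinuousMap.dist_le (half_pos hε).le).2 fun x => ?_
    by_cases h : ∃ a : Fin (m + 1), (T a.succ).1 = j
    · obtain ⟨a, rfl⟩ := h
      rw [hu' a x, Real.dist_eq, add_sub_cancel_left]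
      exact hcoord a _
    · simp only [u', dif_neg h, dist_self]
      exact (half_pos hε).le
  · have heq (a : Fin (m + 1)) : translate u' (T a.succ) x = translate u' (T 0) x :=
      le_antisymm (hx _ ⟨0, rfl⟩ _) (hx _ ⟨a.succ, rfl⟩ _)
    ext a
    have h1 := heq a
    simp only [translate, hu', hu'0, vadd_neg_vadd] at h1
    have h2 : φ x a = translate u (T a.succ) x - translate u (T 0) x := rfl
    simp only [translate] at h2
    simp only [PiLp.zero_apply]
    linarith

/-- On a free compact space of dimension at most `m`, there are functions such that the maximum of
their translates is attained by at most `m + 1` translates at any point, and by at most one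
translate of each function. -/
lemma exists_isTop_injOn [Fact p.Prime] (hX : AvoidsZero X m)
    (hfree : ∀ (g : ZMod p) (x : X), g +ᵥ x = x → g = 0) :
    ∃ (N : ℕ) (u : Fin N → C(X, ℝ)), (∀ x : X, ∃ s : Fin N × ZMod p, IsTop u x s) ∧
      (∀ (x : X) (s t : Fin N × ZMod p), IsTop u x s → IsTop u x t → s.1 = t.1 → s = t) ∧
      ∀ (x : X) (S : Finset (Fin N × ZMod p)), (∀ s ∈ S, IsTop u x s) → S.card ≤ m + 1 := by
  classical
  obtain ⟨N, c, r, hcover, hdisj⟩ := exists_finite_cover hfree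
  -- The set `W` of functions at most one translate of each of which attains the maximum is open,
  -- and it contains the bump functions of the cover, whose supports are disjoint from their translates.
  let W : Set (Fin N → C(X, ℝ)) := ⋂ (s : Fin N × ZMod p) (t : Fin N × ZMod p)
    (_ : s.1 = t.1 ∧ s ≠ t), {u | ∀ x, ¬ ∀ i ∈ ({s, t} : Set (Fin N × ZMod p)), IsTop u x i}
  have hW : IsOpen W := isOpen_iInter_of_finite fun s => isOpen_iInter_of_finite fun t =>
    isOpen_iInter_of_finite fun _ => isOpen_setOf_forall_not_isTop _
  have hWne : W.Nonempty := by
    refine ⟨fun j => ⟨fun x => max 0 (r j - dist x (c j)), by fun_prop⟩, ?_⟩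
    simp only [W, Set.mem_iInter]
    rintro ⟨j, g⟩ ⟨j', h⟩ ⟨rfl, hne⟩ x hx
    obtain ⟨i, hi⟩ := hcover x
    have hpos {s : Fin N × ZMod p} (hs : IsTop (fun j => (⟨fun x => max 0 (r j - dist x (c j)),
        by fun_prop⟩ : C(X, ℝ))) x s) : -s.2 +ᵥ x ∈ closedBall (c s.1) (r s.1) := by
      have h1 := hs (i, 0)
      simp only [translate, ContinuousMap.coe_mk, neg_zero, zero_vadd] at h1
      have h2 : 0 < r i - dist x (c i) := sub_pos.2 hi
      have h3 := (lt_max_of_lt_right h2).trans_le h1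
      rcases lt_max_iff.1 h3 with h4 | h4
      · exact absurd h4 (lt_irrefl _)
      · exact (sub_pos.1 h4).le
    have h1 := hpos (hx (j, g) (by simp))
    have h2 := hpos (hx (j, h) (by simp))
    refine hdisj j _ h1 (g - h) ?_ ?_
    · exact sub_ne_zero.2 fun e => hne (by simp [e])
    · rw [vadd_vadd]
      convert h2 using 2
      abel
  obtain ⟨u, huW, hu⟩ := (dense_iInter_of_isOpen
    (ι := {T : Fin (m + 2) → Fin N × ZMod p // Function.Injective fun a => (T a).1})
    (f := fun T => {u : Fin N → C(X, ℝ) | ∀ x, ¬ ∀ s ∈ Set.range T.1, IsTop u x s})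
    (fun T => isOpen_setOf_forall_not_isTop _)
    (fun T => dense_setOf_forall_not_isTop hX T.2)).inter_open_nonempty W hW hWne
  have hinj : ∀ (x : X) (s t : Fin N × ZMod p), IsTop u x s → IsTop u x t → s.1 = t.1 → s = t := by
    intro x s t hs ht hst
    by_contra hne
    simp only [W, Set.mem_iInter] at huW
    exact huW s t ⟨hst, hne⟩ x (by simp [hs, ht])
  refine ⟨N, u, fun x => ?_, hinj, fun x S hS => ?_⟩
  · obtain ⟨i, -⟩ := hcover x
    obtain ⟨s, -, hs⟩ := Finset.exists_max_image (Finset.univ : Finset (Fin N × ZMod p))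
      (fun s => translate u s x) ⟨(i, 0), Finset.mem_univ _⟩
    exact ⟨s, fun t => hs t (Finset.mem_univ t)⟩
  · by_contra hcard
    obtain ⟨S', hS', hcard'⟩ := Finset.exists_subset_card_eq (show m + 2 ≤ S.card by omega)
    let e := (S'.equivFinOfCardEq hcard').symm
    have hT : Function.Injective fun a => (e a : Fin N × ZMod p).1 := fun a b hab =>
      e.injective (Subtype.ext (hinj x _ _ (hS _ (hS' (e a).2)) (hS _ (hS' (e b).2)) hab))
    refine Set.mem_iInter.1 hu ⟨fun a => e a, hT⟩ x ?_
    rintro _ ⟨a, rfl⟩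
    exact hS _ (hS' (e a).2)

/-- A free compact space of dimension at most `m` has an equivariant labelling such that the labels
near each point span a simplex of dimension at most `m`, with distinct colours. -/
theorem AvoidsZero.exists_labelling [Fact p.Prime] (hX : AvoidsZero X m)
    (hfree : ∀ (g : ZMod p) (x : X), g +ᵥ x = x → g = 0) :
    ∃ lab : X → ℕ × ZMod p, (∀ g x, lab (g +ᵥ x) = ((lab x).1, g + (lab x).2)) ∧
      ∃ δ > 0, ∀ x, ∃ S : Finset (ℕ × ZMod p), S.card ≤ m + 1 ∧
        (∀ q ∈ S, ∀ r ∈ S, q.1 = r.1 → q = r) ∧ ∀ y, dist y x < δ → lab y ∈ S := by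
  classical
  obtain ⟨N, u, hne, hinj, hcard⟩ := exists_isTop_injOn hX hfree
  have hmin (x : X) : ∃ s : Fin N × ZMod p, IsTop u x s ∧
      ∀ t : Fin N × ZMod p, IsTop u x t → s.1 ≤ t.1 := by
    obtain ⟨s, hs⟩ := hne x
    obtain ⟨t, ht, htmin⟩ := Finset.exists_min_image
      (Finset.univ.filter fun s : Fin N × ZMod p => IsTop u x s) Prod.fst ⟨s, by simpa using hs⟩
    exact ⟨t, by simpa using ht, fun t ht => htmin t (by simpa using ht)⟩
  choose lab hlab hlabmin using hmin
  have hequiv (g : ZMod p) (x : X) : lab (g +ᵥ x) = ((lab x).1, g + (lab x).2) := by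
    have h1 : IsTop u (g +ᵥ x) ((lab x).1, g + (lab x).2) := (isTop_vadd_iff u g x _).2 (hlab x)
    refine hinj (g +ᵥ x) _ _ (hlab _) h1 (le_antisymm (hlabmin _ _ h1) ?_)
    have h2 : IsTop u x ((lab (g +ᵥ x)).1, -g + (lab (g +ᵥ x)).2) := by
      rw [← isTop_vadd_iff u g]
      simpa using hlab (g +ᵥ x)
    exact hlabmin x ((lab (g +ᵥ x)).1, -g + (lab (g +ᵥ x)).2) h2
  have hopen (y : X) : IsOpen {x | ∀ s : Fin N × ZMod p, ¬ IsTop u y s → ¬ IsTop u x s} := by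
    simp only [Set.ofPred_forall]
    refine isOpen_iInter_of_finite fun s => isOpen_iInter_of_finite fun _ => ?_
    have htrans (s : Fin N × ZMod p) : Continuous (translate u s) :=
      (u s.1).continuous.comp (continuous_const_vadd _)
    have hclosed : IsClosed {x | IsTop u x s} := by
      simp only [IsTop, Set.ofPred_forall]
      exact isClosed_iInter fun i => isClosed_le (htrans i) (htrans s)
    exact hclosed.isOpen_compl
  obtain ⟨δ, hδ, hball⟩ := lebesgue_number_lemma_of_metric isCompact_univ hopen
    fun x _ => Set.mem_iUnion.2 ⟨x, fun s hs => hs⟩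
  refine ⟨fun x => ((lab x).1, (lab x).2), fun g x => by simp [hequiv], δ, hδ, fun x => ?_⟩
  obtain ⟨y, hy⟩ := hball x (Set.mem_univ x)
  refine ⟨(Finset.univ.filter fun s : Fin N × ZMod p => IsTop u y s).image
    fun s => ((s.1 : ℕ), s.2), Finset.card_image_le.trans (hcard y _ (by simp)), ?_, fun z hz => ?_⟩
  · simp only [Finset.mem_image, Finset.mem_filter, Finset.mem_univ, true_and]
    rintro _ ⟨s, hs, rfl⟩ _ ⟨t, ht, rfl⟩ hst
    rw [hinj y s t hs ht (Fin.ext hst)]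
  · refine Finset.mem_image.2 ⟨lab z, ?_, rfl⟩
    simp only [Finset.mem_filter, Finset.mem_univ, true_and]
    by_contra h
    exact hy hz _ h (hlab z)

end Labelling

end FreeSphere

/-! ### The iterated join of copies of `ZMod p` -/

namespace FreeSphere

open ListChain

variable {p : ℕ} {M : ℕ}

/-- The simplex of the join with vertices `(i, s i)`. Points of the join of `M` copies of `ZMod p`
are described by their barycentric coordinates. -/
def joinCell (s : Fin M → ZMod p) : Set (Fin M × ZMod p → ℝ) :=
  {x | (∀ r, 0 ≤ x r) ∧ ∑ i, x (i, s i) = 1 ∧ ∀ r, r.2 ≠ s r.1 → x r = 0}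

/-- The join of `M` copies of `ZMod p`, as a geometric simplicial complex. -/
def joinSpace (p M : ℕ) : Set (Fin M × ZMod p → ℝ) := ⋃ s, joinCell s

/-- The vertex `(i, g)` of the join. Pairs with `i ≥ M` are sent to the junk value `0`. -/
def joinVertex (M : ℕ) (q : ℕ × ZMod p) : Fin M × ZMod p → ℝ :=
  fun r => if (r.1 : ℕ) = q.1 ∧ r.2 = q.2 then 1 else 0

/-- The action of `ZMod p` on the space of barycentric coordinates. -/
def shift (g : ZMod p) : (Fin M × ZMod p → ℝ) →ₗ[ℝ] (Fin M × ZMod p → ℝ) :=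
  LinearMap.funLeft ℝ ℝ fun r => (r.1, r.2 - g)

lemma shift_apply (g : ZMod p) (x : Fin M × ZMod p → ℝ) (r : Fin M × ZMod p) :
    shift g x r = x (r.1, r.2 - g) := rfl

lemma shift_shift (g h : ZMod p) (x : Fin M × ZMod p → ℝ) :
    shift g (shift h x) = shift (g + h) x := by
  ext r
  simp only [shift_apply]
  congr 2
  abel

lemma shift_joinVertex (g : ZMod p) (q : ℕ × ZMod p) :
    shift g (joinVertex M q) = joinVertex M (q.1, g + q.2) := by
  ext r
  simp only [shift_apply, joinVertex, sub_eq_iff_eq_add']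

lemma shift_mem_joinSpace (g : ZMod p) {x : Fin M × ZMod p → ℝ} (hx : x ∈ joinSpace p M) :
    shift g x ∈ joinSpace p M := by
  obtain ⟨s, h1, h2, h3⟩ := Set.mem_iUnion.1 hx
  refine Set.mem_iUnion.2 ⟨fun i => s i + g, fun r => h1 _, ?_, fun r hr => h3 _ ?_⟩
  · simpa [shift_apply] using h2
  · exact fun h => hr (sub_eq_iff_eq_add.1 h)

instance : VAdd (ZMod p) (joinSpace p M) where
  vadd g x := ⟨shift g x, shift_mem_joinSpace g x.2⟩

lemma coe_vadd (g : ZMod p) (x : joinSpace p M) :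
    ((g +ᵥ x : joinSpace p M) : Fin M × ZMod p → ℝ) = shift g x := rfl

instance : AddAction (ZMod p) (joinSpace p M) where
  zero_vadd x := Subtype.ext (by ext r; simp [coe_vadd, shift_apply])
  add_vadd g h x := Subtype.ext (by simp only [coe_vadd, shift_shift])

instance : ContinuousConstVAdd (ZMod p) (joinSpace p M) where
  continuous_const_vadd g := by
    refine Continuous.subtype_mk (f := fun x : joinSpace p M => shift g x.1) ?_ _
    exact continuous_pi fun r =>
      (continuous_apply (r.1, r.2 - g)).comp continuous_subtype_val

lemma joinSpace_free (g : ZMod p) (x : joinSpace p M) (h : g +ᵥ x = x) : g = 0 := by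
  obtain ⟨s, -, h2, h3⟩ := Set.mem_iUnion.1 x.2
  have : ∃ i, (x : Fin M × ZMod p → ℝ) (i, s i) ≠ 0 := by
    by_contra! hall
    simp [hall] at h2
  obtain ⟨i, hi⟩ := this
  have hx : (x : Fin M × ZMod p → ℝ) (i, s i - g) ≠ 0 := by
    have := congrArg (fun y : joinSpace p M => (y : Fin M × ZMod p → ℝ) (i, s i)) h
    simp only [coe_vadd, shift_apply] at this
    rwa [this]
  by_contra hg
  exact hx (h3 (i, s i - g) fun e => hg (by simpa using e))

lemma convex_joinCell (s : Fin M → ZMod p) : Convex ℝ (joinCell s) := by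
  rintro x ⟨hx1, hx2, hx3⟩ y ⟨hy1, hy2, hy3⟩ a b ha hb hab
  refine ⟨fun r => ?_, ?_, fun r hr => ?_⟩
  · have := hx1 r
    have := hy1 r
    simp only [Pi.add_apply, Pi.smul_apply, smul_eq_mul]
    positivity
  · simp only [Pi.add_apply, Pi.smul_apply, smul_eq_mul, Finset.sum_add_distrib, ← Finset.mul_sum]
    rw [hx2, hy2]
    linarith
  · simp [hx3 r hr, hy3 r hr]

lemma mem_Icc_of_mem_joinCell {s : Fin M → ZMod p} {x : Fin M × ZMod p → ℝ} (hx : x ∈ joinCell s)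
    (r : Fin M × ZMod p) : x r ∈ Set.Icc (0 : ℝ) 1 := by
  obtain ⟨h1, h2, h3⟩ := hx
  refine ⟨h1 r, ?_⟩
  by_cases hr : r.2 = s r.1
  · rw [← h2]
    have := Finset.single_le_sum (f := fun i => x (i, s i)) (fun i _ => h1 _) (Finset.mem_univ r.1)
    simpa [← hr] using this
  · rw [h3 r hr]
    exact zero_le_one

lemma joinVertex_mem_joinCell {s : ℕ → ZMod p} {q : ℕ × ZMod p} (hq : q.1 < M)
    (hs : q.2 = s q.1) : joinVertex M q ∈ joinCell fun i : Fin M => s i := by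
  refine ⟨fun r => ?_, ?_, fun r hr => ?_⟩
  · simp only [joinVertex]
    split_ifs <;> norm_num
  · rw [Finset.sum_eq_single (⟨q.1, hq⟩ : Fin M)]
    · simp [joinVertex, hs]
    · intro i _ hi
      simp only [joinVertex]
      exact if_neg fun h => hi (Fin.ext h.1)
    · simp
  · simp only [joinVertex]
    refine if_neg fun h => hr ?_
    rw [h.2, hs, ← h.1]

variable [Fact p.Prime]

lemma dist_le_one_of_mem_joinCell {s : Fin M → ZMod p} {x y : Fin M × ZMod p → ℝ}
    (hx : x ∈ joinCell s) (hy : y ∈ joinCell s) : dist x y ≤ 1 := by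
  refine (dist_pi_le_iff zero_le_one).2 fun r => ?_
  have h1 := mem_Icc_of_mem_joinCell hx r
  have h2 := mem_Icc_of_mem_joinCell hy r
  rw [Real.dist_eq, abs_le]
  constructor <;> linarith [h1.1, h1.2, h2.1, h2.2]

lemma isCompact_joinSpace (p M : ℕ) [Fact p.Prime] : IsCompact (joinSpace p M) := by
  refine isCompact_iUnion fun s => ?_
  refine (isCompact_univ_pi fun _ : Fin M × ZMod p => isCompact_Icc (a := (0 : ℝ))
    (b := 1)).of_isClosed_subset ?_ fun x hx r _ => mem_Icc_of_mem_joinCell hx r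
  simp only [joinCell, Set.ofPred_and, Set.ofPred_forall]
  refine (isClosed_iInter fun r => isClosed_le continuous_const (continuous_apply r)).inter
    (IsClosed.inter (isClosed_eq (by fun_prop) continuous_const)
      (isClosed_iInter fun r => isClosed_iInter fun _ => isClosed_eq (continuous_apply r)
        continuous_const))

instance : CompactSpace (joinSpace p M) := isCompact_iff_compactSpace.1 (isCompact_joinSpace p M)

lemma dimH_joinSpace_le (p M : ℕ) [Fact p.Prime] : dimH (joinSpace p (M + 1)) ≤ M := by
  rw [joinSpace, dimH_iUnion]
  refine iSup_le fun s => ?_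
  -- The cell is parametrized by all its barycentric coordinates but the first.
  let P : (Fin M → ℝ) → (Fin (M + 1) × ZMod p → ℝ) := fun t r =>
    if r.2 = s r.1 then Fin.cases (1 - ∑ i, t i) t r.1 else 0
  have hP : ContDiff ℝ 1 P := by
    refine contDiff_pi.2 fun r => ?_
    by_cases hr : r.2 = s r.1
    · simp only [P, if_pos hr]
      obtain ⟨i, g⟩ := r
      induction i using Fin.cases with
      | zero => simp only [Fin.cases_zero]; fun_prop
      | succ i => simp only [Fin.cases_succ]; fun_prop
    · simp only [P, if_neg hr]
      exact contDiff_const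
  have hsub : joinCell s ⊆ Set.range P := by
    rintro x ⟨-, h2, h3⟩
    refine ⟨fun i => x (i.succ, s i.succ), ?_⟩
    ext ⟨i, g⟩
    by_cases hr : g = s i
    · subst hr
      induction i using Fin.cases with
      | zero =>
        rw [Fin.sum_univ_succ] at h2
        simp only [P, if_true, Fin.cases_zero]
        linarith
      | succ i => simp [P]
    · simp only [P, if_neg hr]
      exact (h3 _ hr).symm
  simpa using (dimH_mono hsub).trans hP.dimH_range_le

lemma avoidsZero_joinSpace {n : ℕ} (h : M ≤ n) : AvoidsZero (joinSpace p (M + 1)) n :=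
  avoidsZero_of_dimH_lt (isCompact_joinSpace p (M + 1)).isClosed
    ((dimH_joinSpace_le p M).trans_lt (by exact_mod_cast Nat.lt_succ_of_le h))

/-- The join carries arbitrarily fine resolution chains. -/
lemma exists_fine_resolution_joinSpace (p M : ℕ) [Fact p.Prime] {ε : ℝ} (hε : 0 < ε) :
    ∃ d : ℕ → Chain (ZMod p) (Fin M × ZMod p → ℝ), IsResolution (fun g => shift g) M d ∧
      ∀ k ≤ M, d k ∈ Finsupp.supported (ZMod p) (ZMod p)
        {l : List (Fin M × ZMod p → ℝ) | (∀ v ∈ l, v ∈ joinSpace p M) ∧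
          ∀ v ∈ l, ∀ w ∈ l, dist v w ≤ ε} := by
  have hd : IsResolution (fun g => shift (M := M) g) M
      fun k => map (joinVertex M) (joinChain p k) := by
    refine (isResolution_joinChain M).push (fun _ => map (joinVertex M)) (by simp)
      (fun k c => (map_bdry _ c).symm) fun k _ g => ?_
    rw [map_map, map_map]
    congr 2
    ext q : 1
    exact (shift_joinVertex g q).symm
  have hcells : ∀ k ≤ M, map (joinVertex M) (joinChain p k) ∈ Finsupp.supported (ZMod p) (ZMod p)
      {l : List (Fin M × ZMod p → ℝ) | l.length ≤ M ∧
        (∃ C ∈ Set.range joinCell, ∀ v ∈ l, v ∈ C) ∧ ∀ v ∈ l, ∀ w ∈ l, dist v w ≤ 1} := by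
    refine fun k hk => map_mem_supported ?_ (joinChain_mem_supported k)
    rintro l ⟨hlen, s, hs⟩
    have hcell : ∀ v ∈ l.map (joinVertex M), v ∈ joinCell fun i : Fin M => s i := by
      intro v hv
      obtain ⟨q, hq, rfl⟩ := List.mem_map.1 hv
      exact joinVertex_mem_joinCell ((hs q hq).1.trans_le hk) (hs q hq).2
    exact ⟨by simpa [hlen] using hk, ⟨_, ⟨_, rfl⟩, hcell⟩,
      fun v hv w hw => dist_le_one_of_mem_joinCell (hcell v hv) (hcell w hw)⟩
  obtain ⟨d, hd, hsupp⟩ := hd.exists_fine (𝒞 := Set.range joinCell)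
    (by rintro _ ⟨s, rfl⟩; exact convex_joinCell s) hcells hε
  refine ⟨d, hd, fun k hk => supported_mono ?_ (hsupp k hk)⟩
  rintro l ⟨⟨_, ⟨s, rfl⟩, hl⟩, hdist⟩
  exact ⟨fun v hv => Set.mem_iUnion.2 ⟨s, hl v hv⟩, hdist⟩

/-! ### Nonexistence of equivariant maps -/

/-- The join of `m + 2` copies of `ZMod p` has no equivariant map to a free compact space of
dimension at most `m`. -/
theorem not_exists_equivariant_joinSpace {m : ℕ} {Y : Type*} [MetricSpace Y] [CompactSpace Y]
    [AddAction (ZMod p) Y] [ContinuousConstVAdd (ZMod p) Y] (hY : AvoidsZero Y m)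
    (hfree : ∀ (g : ZMod p) (y : Y), g +ᵥ y = y → g = 0) (h : joinSpace p (m + 2) → Y)
    (hcont : Continuous h) (hequiv : ∀ (g : ZMod p) x, h (g +ᵥ x) = g +ᵥ h x) : False := by
  classical
  obtain ⟨lab, hlab, δ, hδ, hS⟩ := hY.exists_labelling hfree
  obtain ⟨ε, hε, hunif⟩ := Metric.uniformContinuous_iff.1
    (CompactSpace.uniformContinuous_of_continuous hcont) δ hδ
  obtain ⟨d, hd, hsupp⟩ := exists_fine_resolution_joinSpace p (m + 2) (half_pos hε)
  -- The label of a point of the join; it is only relevant on the join itself.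
  let L : (Fin (m + 2) × ZMod p → ℝ) → ℕ × ZMod p := fun x =>
    if hx : x ∈ joinSpace p (m + 2) then lab (h ⟨x, hx⟩) else (0, 0)
  have hL (x) (hx : x ∈ joinSpace p (m + 2)) : L x = lab (h ⟨x, hx⟩) := dif_pos hx
  have hLshift (g : ZMod p) (x) (hx : x ∈ joinSpace p (m + 2)) :
      L (shift g x) = ((L x).1, g + (L x).2) := by
    rw [hL _ (shift_mem_joinSpace g hx), hL x hx, ← hlab, ← hequiv]
    rfl
  have hd1 : IsResolution (fun g (q : ℕ × ZMod p) => (q.1, g + q.2)) (m + 2)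
      fun k => map L (d k) := by
    refine hd.push (fun _ => map L) (by simp) (fun k c => (map_bdry _ c).symm) fun k hk g => ?_
    rw [map_map, map_map]
    refine eq_of_forall_mem (fun l hl => ?_) (hsupp k hk)
    rw [map_single, map_single]
    congr 1
    exact List.map_congr_left fun v hv => hLshift g v (hl.1 v hv)
  have hd2 : IsResolution (· + ·) (m + 2)
      fun k => map Prod.snd (sd topVertex k (map L (d k))) := by
    refine hd1.push (fun k => map Prod.snd ∘ₗ sd topVertex k) (by simp [sd_zero_nil])
      (fun k c => by simp [← map_bdry, bdry_sd]) fun k _ g => ?_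
    simp only [LinearMap.comp_apply]
    rw [← map_sd (g := fun q : ℕ × ZMod p => (q.1, g + q.2)) fun l hl => topVertex_map g hl,
      map_map, map_map]
    rfl
  have h1 := hd2.eval_fundClass (fun k => map_mem_supported (fun l hl => by simpa using hl)
    (sd_mem_supported_length topVertex k _)) (m + 1) (Nat.lt_succ_self _)
  refine zero_ne_one (α := ZMod p) ?_
  rw [← h1]
  refine (eval_fundClass_sd_topVertex_eq_zero (map_mem_supported ?_ (hsupp (m + 2) le_rfl))).symm
  rintro l ⟨hmem, hdist⟩
  rcases l with _ | ⟨v, l⟩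
  · exact ⟨∅, by simp⟩
  · have hv := hmem v List.mem_cons_self
    obtain ⟨S, hcard, hinj, hmemS⟩ := hS (h ⟨v, hv⟩)
    refine ⟨S, hcard, hinj, fun q hq => ?_⟩
    obtain ⟨w, hw, rfl⟩ := List.mem_map.1 hq
    rw [hL w (hmem w hw)]
    refine hmemS _ (hunif ?_)
    exact (hdist w hw v List.mem_cons_self).trans_lt (half_lt_self hε)

end FreeSphere

theorem mainTheorem1 (p n m : ℕ) [Fact p.Prime]
    [AddAction (ZMod p) (Metric.sphere (0 : EuclideanSpace ℝ (Fin (n + 1))) 1)]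
    [ContinuousConstVAdd (ZMod p) (Metric.sphere (0 : EuclideanSpace ℝ (Fin (n + 1))) 1)]
    [AddAction (ZMod p) (Metric.sphere (0 : EuclideanSpace ℝ (Fin (m + 1))) 1)]
    [ContinuousConstVAdd (ZMod p) (Metric.sphere (0 : EuclideanSpace ℝ (Fin (m + 1))) 1)]
    (hn : ∀ (g : ZMod p) (x : Metric.sphere (0 : EuclideanSpace ℝ (Fin (n + 1))) 1),
      g +ᵥ x = x → g = 0)
    (hm : ∀ (g : ZMod p) (y : Metric.sphere (0 : EuclideanSpace ℝ (Fin (m + 1))) 1),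
      g +ᵥ y = y → g = 0)
    (f : Metric.sphere (0 : EuclideanSpace ℝ (Fin (n + 1))) 1 →
      Metric.sphere (0 : EuclideanSpace ℝ (Fin (m + 1))) 1)
    (hf : Continuous f)
    (hequiv : ∀ (g : ZMod p) (x : Metric.sphere (0 : EuclideanSpace ℝ (Fin (n + 1))) 1),
      f (g +ᵥ x) = g +ᵥ f x) :
    n ≤ m := by
  by_contra! hlt
  obtain ⟨φ, hφ, hφequiv⟩ :=
    (FreeSphere.avoidsZero_joinSpace (p := p) (M := m + 1) hlt).exists_equivariant (p := p)
      FreeSphere.joinSpace_free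
  exact FreeSphere.not_exists_equivariant_joinSpace (FreeSphere.avoidsZero_sphere m) hm (f ∘ φ)
    (hf.comp hφ) fun g x => by simp only [Function.comp_apply, hφequiv, hequiv]
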